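/- Let $K$ be an algebraically closed field of characteristic $3$, let $X\subset\mathbb P^3_K$ be a K3 quartic surface, i.e. a surface of degree $4$ whose singularities are at most (isolated) rational double points, with minimal desingularization $\rho:Z\to X$, and let $\ell$ be a line lying on $X$, with strict transform $L\subset Z$. The pencil of planes $\Pi_t$ ($t\in\mathbb P^1$) containing $\ell$ induces a genus $1$ fibration $\pi:Z\to\mathbb P^1$, whose fibers come from the residual cubics $E_t$ defined by $X\cap\Pi_t=\ell+E_t$. The line $\ell$ is called inseparable if $\pi|_L:L\to\mathbb P^1$ is a non-constant inseparable morphism; quasi-elliptic if $\pi$ is quasi-elliptic, i.e. if for all but finitely many $t$ the fiber (equivalently, $E_t$) is an irreducible curve with a cusp; and cuspidal if it is quasi-elliptic and the cuspidal curve of $\pi$ (the closure of the set of cusps of the general fibers) is equal to $L$. The valency $v(\ell)$ is the number of lines on $X$ distinct from $\ell$ which meet $\ell$ in a smooth point of $X$. Then: (1) If $\ell$ is inseparable and $v(\ell)>12$, then $\ell$ is cuspidal. (2) If $\ell$ is cuspidal, then $X$ is projectively equivalent to a surface $$x_0x_3^3-x_1x_2^3+x_2\,q_3(x_0,x_1)+x_3\,q_3'(x_0,x_1)+q_4(x_0,x_1)=0,$$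 where $q_3$, $q_3'$, $q_4$ are (possibly zero) forms over $K$ of degree $3$, $3$ and $4$, respectively. -/

import Mathlib

open scoped LinearAlgebra.Projectivization

namespace QuarticLines

variable {K : Type*} [Field K]

/-- The form `F` written in the linear coordinates `x₀, …, x₃` in which the point with coordinate
vector `x` is the point `A x` of the ambient space, i.e. the form `F(A x)`. -/
noncomputable def coords (A : GL (Fin 4) K) (F : MvPolynomial (Fin 4) K) :
    MvPolynomial (Fin 4) K :=
  MvPolynomial.aeval
    (fun i => ∑ j, MvPolynomial.C ((A : Matrix (Fin 4) (Fin 4) K) i j) * MvPolynomial.X j) F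

/-- The quartic surfaces `F = 0` and `G = 0` in `ℙ³` are projectively equivalent. -/
def ProjectivelyEquivalent (F G : MvPolynomial (Fin 4) K) : Prop :=
  ∃ (A : GL (Fin 4) K) (c : K), c ≠ 0 ∧ coords A F = MvPolynomial.C c * G

/-- The singular points of the surface `F = 0` in `ℙ³`. -/
def singularPoints (F : MvPolynomial (Fin 4) K) : Set (ℙ K (Fin 4 → K)) :=
  {P | MvPolynomial.eval P.rep F = 0 ∧
    ∀ i, MvPolynomial.eval P.rep (MvPolynomial.pderiv i F) = 0}

section RationalDoublePoints

open MvPolynomial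

/-- The equations of the rational double points over an algebraically closed field of
characteristic 3 (Artin's list): `A n` (`n ≥ 1`), `D n` (`n ≥ 4`), `E₆⁰`, `E₆¹`, `E₇⁰`, `E₇¹`,
`E₈⁰`, `E₈¹`, `E₈²`, in the variables `x = X 0`, `y = X 1`, `z = X 2`. -/
inductive IsADENormalForm : MvPolynomial (Fin 3) K → Prop
  | A (n : ℕ) (hn : 1 ≤ n) : IsADENormalForm (X 2 ^ (n + 1) + X 0 * X 1)
  | D (n : ℕ) (hn : 4 ≤ n) : IsADENormalForm (X 2 ^ 2 + X 0 ^ 2 * X 1 + X 1 ^ (n - 1))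
  | E60 : IsADENormalForm (X 2 ^ 2 + X 0 ^ 3 + X 1 ^ 4)
  | E61 : IsADENormalForm (X 2 ^ 2 + X 0 ^ 3 + X 1 ^ 4 + X 0 ^ 2 * X 1 ^ 2)
  | E70 : IsADENormalForm (X 2 ^ 2 + X 0 ^ 3 + X 0 * X 1 ^ 3)
  | E71 : IsADENormalForm (X 2 ^ 2 + X 0 ^ 3 + X 0 * X 1 ^ 3 + X 0 ^ 2 * X 1 ^ 2)
  | E80 : IsADENormalForm (X 2 ^ 2 + X 0 ^ 3 + X 1 ^ 5)
  | E81 : IsADENormalForm (X 2 ^ 2 + X 0 ^ 3 + X 1 ^ 5 + X 0 ^ 2 * X 1 ^ 3)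
  | E82 : IsADENormalForm (X 2 ^ 2 + X 0 ^ 3 + X 1 ^ 5 + X 0 ^ 2 * X 1 ^ 2)

/-- The ring `K⟦x, y, z⟧ / (f)`. For `f(0) = 0` it is the completed local ring at the origin of the
affine surface `f = 0`. -/
abbrev CompletedLocalRing (f : MvPolynomial (Fin 3) K) : Type _ :=
  MvPowerSeries (Fin 3) K ⧸ Ideal.span {(f : MvPowerSeries (Fin 3) K)}

/-- The affine equation of `G = 0` in the chart `x₀ = 1`. -/
noncomputable def affineEquation (G : MvPolynomial (Fin 4) K) : MvPolynomial (Fin 3) K :=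
  aeval ![1, X 0, X 1, X 2] G

/-- `P` is a rational double point of the surface `F = 0` (over an algebraically closed field of
characteristic 3): in linear coordinates with `P = [1 : 0 : 0 : 0]`, the completed local ring at `P`,
computed in the affine chart `x₀ = 1`, is that of one of the normal forms. -/
def IsRationalDoublePoint (F : MvPolynomial (Fin 4) K) (P : ℙ K (Fin 4 → K)) : Prop :=
  ∃ A : GL (Fin 4) K, P.submodule = K ∙ ((A : Matrix (Fin 4) (Fin 4) K).mulVec ![1, 0, 0, 0]) ∧
    ∃ g : MvPolynomial (Fin 3) K, IsADENormalForm g ∧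
      Nonempty (CompletedLocalRing (affineEquation (coords A F)) ≃ₐ[K]
        CompletedLocalRing g)

end RationalDoublePoints

/-- `F = 0` is a K3 quartic surface (over an algebraically closed field of characteristic 3): a
surface of degree 4 in `ℙ³` whose singularities are isolated and are rational double points. -/
structure IsK3Quartic (F : MvPolynomial (Fin 4) K) : Prop where
  isHomogeneous : F.IsHomogeneous 4
  isolated : (singularPoints F).Finite
  rationalDoublePoint : ∀ P ∈ singularPoints F, IsRationalDoublePoint F P

/-- `ℓ` is a line of `ℙ³` (given as a plane in `K⁴`) that lies on the surface `F = 0`. -/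
structure IsLineOn (F : MvPolynomial (Fin 4) K) (ℓ : Submodule K (Fin 4 → K)) : Prop where
  finrank_eq : Module.finrank K ℓ = 2
  eval_eq_zero : ∀ v ∈ ℓ, MvPolynomial.eval v F = 0

/-- The points of the line `ℓ`. -/
def points (ℓ : Submodule K (Fin 4 → K)) : Set (ℙ K (Fin 4 → K)) := {P | P.submodule ≤ ℓ}

/-- The valency of a line `ℓ` on the surface `F = 0`: the number of lines on the surface that are
distinct from `ℓ` and meet `ℓ` in a smooth point of the surface. -/
noncomputable def valency (F : MvPolynomial (Fin 4) K) (ℓ : Submodule K (Fin 4 → K)) : ℕ∞ :=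
  {m : Submodule K (Fin 4 → K) | IsLineOn F m ∧ m ≠ ℓ ∧
    ∃ P ∈ points m ∩ points ℓ, P ∉ singularPoints F}.encard

/-- In the coordinates given by `A`, the line `ℓ` is `x₀ = x₁ = 0`. -/
def IsAdapted (A : GL (Fin 4) K) (ℓ : Submodule K (Fin 4 → K)) : Prop :=
  ℓ = Submodule.span K {(A : Matrix (Fin 4) (Fin 4) K).mulVec ![0, 0, 1, 0],
    (A : Matrix (Fin 4) (Fin 4) K).mulVec ![0, 0, 0, 1]}

section Inseparable

open Polynomial IntermediateField

/-- For `k = 0, 1`: the derivative `∂G/∂x_k` at the point `[0 : 0 : u : 1]` of the line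
`x₀ = x₁ = 0`, as a polynomial in `u`. If the line lies on the surface `G = 0`, these are the
dehomogenized forms `α` (`k = 0`) and `β` (`k = 1`) such that the residual cubic in the plane
`x₀ = t x₁` meets the line in the zeros of `t α + β`. -/
noncomputable def normalDerivative (k : Fin 4) (G : MvPolynomial (Fin 4) K) : K[X] :=
  MvPolynomial.aeval ![0, 0, X, 1] (MvPolynomial.pderiv k G)

/-- The rational function `t = -β/α` of `u` by which the pencil of planes `x₀ = t x₁` gives the
morphism from the line `x₀ = x₁ = 0`, identified with its strict transform, to `ℙ¹`. -/
noncomputable def inducedMap (G : MvPolynomial (Fin 4) K) : RatFunc K :=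
  -(algebraMap K[X] (RatFunc K) (normalDerivative 1 G)) /
    algebraMap K[X] (RatFunc K) (normalDerivative 0 G)

/-- The line `ℓ` is inseparable: the morphism `L → ℙ¹` induced by the pencil of planes through `ℓ`
is not constant, and its extension of function fields `K(u) / K(t)` is not separable. (Whether this
holds does not depend on the choice of the adapted coordinates.) -/
def IsInseparable (F : MvPolynomial (Fin 4) K) (ℓ : Submodule K (Fin 4 → K)) : Prop :=
  ∃ A : GL (Fin 4) K, IsAdapted A ℓ ∧
    inducedMap (coords A F) ∉ Set.range (algebraMap K (RatFunc K)) ∧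
    ¬ Algebra.IsSeparable K⟮inducedMap (coords A F)⟯ (RatFunc K)

end Inseparable

section Cuspidal

open MvPolynomial

/-- The residual cubic `E_t` in the plane `x₀ = t x₁`, in the variables `x₁, x₂, x₃` (numbered
`0, 1, 2`): substitute `t x₁` for `x₀` in `G` and divide by `x₁`. -/
noncomputable def residualCubic (G : MvPolynomial (Fin 4) K) (t : K) : MvPolynomial (Fin 3) K :=
  (aeval ![C t * X 0, X 0, X 1, X 2] G).divMonomial (Finsupp.single 0 1)

/-- The point with coordinates `p` of the plane cubic `g = 0` is a double point with a double
tangent: it is singular and the Hessian matrix, which represents (up to the factor 2) the leading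
form of `g` there, has rank one. On an irreducible cubic in characteristic different from 2 these are
exactly the cusps. -/
def IsCusp (g : MvPolynomial (Fin 3) K) (p : Fin 3 → K) : Prop :=
  p ≠ 0 ∧ eval p g = 0 ∧ (∀ i, eval p (pderiv i g) = 0) ∧
    (Matrix.of fun i j => eval p (pderiv i (pderiv j g))).rank = 1

/-- The general fibres of the fibration induced by the line `x₀ = x₁ = 0` on `G = 0` are irreducible
cubics with a cusp. -/
def HasCuspidalGeneralFiber (G : MvPolynomial (Fin 4) K) : Prop :=
  {t : K | ¬ (Irreducible (residualCubic G t) ∧ ∃ p, IsCusp (residualCubic G t) p)}.Finite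

/-- The line `ℓ` on `F = 0` is quasi-elliptic. (Whether this holds does not depend on the choice of
the adapted coordinates.) -/
def IsQuasiElliptic (F : MvPolynomial (Fin 4) K) (ℓ : Submodule K (Fin 4 → K)) : Prop :=
  ∃ A : GL (Fin 4) K, IsAdapted A ℓ ∧ HasCuspidalGeneralFiber (coords A F)

/-- The points of `ℙ³` that are cusps of a residual cubic `E_t` with `t ∉ S`. -/
def cusps (A : GL (Fin 4) K) (F : MvPolynomial (Fin 4) K) (S : Set K) : Set (ℙ K (Fin 4 → K)) :=
  {P | ∃ t ∉ S, ∃ p, IsCusp (residualCubic (coords A F) t) p ∧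
    P.submodule = K ∙ ((A : Matrix (Fin 4) (Fin 4) K).mulVec ![t * p 0, p 0, p 1, p 2])}

/-- The Zariski closure of a set of points of `ℙ³`. -/
def zariskiClosure (T : Set (ℙ K (Fin 4 → K))) : Set (ℙ K (Fin 4 → K)) :=
  {Q | ∀ (n : ℕ) (H : MvPolynomial (Fin 4) K), H.IsHomogeneous n →
    (∀ P ∈ T, eval P.rep H = 0) → eval Q.rep H = 0}

/-- `D` is the cuspidal curve (in `ℙ³`) of the fibration: the closure of the cusps of the general
fibres, that is, of the cusps of all fibres but finitely many, however many more are left out. -/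
def IsCuspidalCurve (A : GL (Fin 4) K) (F : MvPolynomial (Fin 4) K)
    (D : Set (ℙ K (Fin 4 → K))) : Prop :=
  ∃ S₀ : Set K, S₀.Finite ∧ ∀ S : Set K, S.Finite → S₀ ⊆ S → zariskiClosure (cusps A F S) = D

/-- The line `ℓ` on `F = 0` is cuspidal: it is quasi-elliptic, and the cuspidal curve of its
fibration is the line itself. (Whether this holds does not depend on the choice of the adapted
coordinates.) -/
def IsCuspidal (F : MvPolynomial (Fin 4) K) (ℓ : Submodule K (Fin 4 → K)) : Prop :=
  IsQuasiElliptic F ℓ ∧ ∃ A : GL (Fin 4) K, IsAdapted A ℓ ∧ IsCuspidalCurve A F (points ℓ)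

/-- The member `x₀x₃³ - x₁x₂³ + x₂q₃(x₀,x₁) + x₃q₃'(x₀,x₁) + q₄(x₀,x₁)` of the family. -/
noncomputable def familyC (q₃ q₃' q₄ : MvPolynomial (Fin 2) K) : MvPolynomial (Fin 4) K :=
  X 0 * X 3 ^ 3 - X 1 * X 2 ^ 3 + X 2 * rename ![0, 1] q₃ + X 3 * rename ![0, 1] q₃'
    + rename ![0, 1] q₄

end Cuspidal

end QuarticLines

/-!
Take coordinates in which `ℓ` is `x₀ = x₁ = 0` and expand the quartic in powers of `x₀, x₁`. Its
linear part `x₀ α(x₂, x₃) + x₁ β(x₂, x₃)` determines `π|_L`: the residual cubic of the plane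
`x₀ = t x₁` meets `ℓ` where `t α + β = 0`. If `π|_L` is inseparable, or if the cusps of the residual
cubics are dense in `ℓ`, then the Wronskian of `α` and `β` vanishes; in characteristic 3 these
binary cubics are then combinations of `x₂³` and `x₃³`, and after a change of coordinates the linear
part is `x₀ x₃³ - x₁ x₂³`.

Now the residual cubic of the plane `x₀ = s³ x₁` meets `ℓ` only in `[0 : 0 : s : 1]`, with
multiplicity 3. It is singular there precisely when `s` is a root of a polynomial `T` of degree at
most 8, built from the part of the quartic that is quadratic in `x₀, x₁`. A line meeting `ℓ` in the
point `[0 : 0 : s : 1]` lies on the surface only if `T(s) = 0`; there are at most three such lines,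
and at most one if `s` is a simple root of `T`. Hence if `T ≠ 0` (its roots at infinity included),
at most `3 · 8 / 2 = 12` lines meet `ℓ`.

If `T = 0`, the whole quadratic part vanishes and the quartic has the shape required in (2); this
applies to a cuspidal line, whose infinitely many cusps are roots of `T`. The residual cubics become
`(s x₂ - x₁)³ + x₀² (b₀ x₂ + b₁ x₁) + m x₀³`, with a cusp on `ℓ` unless `b₀ + b₁ s = 0`. If that
happened for all `s`, the part of the quartic cubic in `x₀, x₁` would vanish too, and the surface
would be singular along a curve. So for `T = 0` the line is cuspidal, which gives (1).
-/

namespace QuarticLines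

section LinearSubstitution

open MvPolynomial

variable {K σ τ : Type*} [Field K]

theorem aeval_mul_left_of_isHomogeneous {S : Type*} [CommRing S] [Algebra K S]
    {G : MvPolynomial σ K} {n : ℕ} (hG : G.IsHomogeneous n) (a : S) (v : σ → S) :
    aeval (fun i => a * v i) G = a ^ n * aeval v G := by
  simp only [aeval_def, eval₂_eq, mul_pow, Finset.prod_mul_distrib, Finset.prod_pow_eq_pow_sum,
    Finset.mul_sum]
  refine Finset.sum_congr rfl fun d hd => ?_
  rw [hG.degree_eq_sum_deg_support hd]
  exact mul_left_comm _ _ _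

theorem eval_smul_of_isHomogeneous {G : MvPolynomial σ K} {n : ℕ}
    (hG : G.IsHomogeneous n) (a : K) (v : σ → K) : eval (a • v) G = a ^ n * eval v G :=
  aeval_mul_left_of_isHomogeneous hG a v

theorem pderiv_aeval [Fintype σ] (i : τ) (f : σ → MvPolynomial τ K) (G : MvPolynomial σ K) :
    pderiv i (aeval f G) = ∑ j, aeval f (pderiv j G) * pderiv i (f j) := by
  classical
  induction G using MvPolynomial.induction_on with
  | C a => simp
  | add p q hp hq => simp only [map_add, hp, hq, add_mul, Finset.sum_add_distrib]
  | mul_X p k hp =>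
    simp only [map_mul, aeval_X, Derivation.leibniz, hp, smul_eq_mul, map_add, pderiv_X,
      add_mul, Finset.sum_add_distrib, Finset.mul_sum]
    congr 1
    · simp [Pi.single_apply]
    · exact Finset.sum_congr rfl fun _ _ => by ring

theorem isHomogeneous_aeval_linear [Fintype τ] (M : Matrix σ τ K) {G : MvPolynomial σ K} {n : ℕ}
    (hG : G.IsHomogeneous n) : (aeval (fun i => ∑ j, C (M i j) * X j) G).IsHomogeneous n := by
  have h := hG.aeval (n := 1) (fun i => ∑ j, C (M i j) * X j) fun i =>
    IsHomogeneous.sum _ _ _ fun j _ => isHomogeneous_C_mul_X _ j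
  rwa [one_mul] at h

theorem eval_aeval_linear [Fintype τ] (M : Matrix σ τ K) (G : MvPolynomial σ K) (v : τ → K) :
    eval v (aeval (fun i => ∑ j, C (M i j) * X j) G) = eval (M.mulVec v) G := by
  rw [← coe_aeval_eq_eval, ← coe_aeval_eq_eval]
  change (aeval v) (aeval _ G) = _
  rw [comp_aeval_apply]
  refine congrArg (aeval · G) (funext fun i => ?_)
  simp only [Matrix.mulVec, dotProduct, map_sum, map_mul, aeval_C, aeval_X, Algebra.algebraMap_self,
    RingHom.id_apply]

theorem isHomogeneous_coords (A : GL (Fin 4) K) {F : MvPolynomial (Fin 4) K} {n : ℕ}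
    (hF : F.IsHomogeneous n) : (coords A F).IsHomogeneous n :=
  isHomogeneous_aeval_linear A.val hF

theorem eval_coords (A : GL (Fin 4) K) (F : MvPolynomial (Fin 4) K) (v : Fin 4 → K) :
    eval v (coords A F) = eval (A.val.mulVec v) F :=
  eval_aeval_linear A.val F v

theorem coords_mul (A B : GL (Fin 4) K) (F : MvPolynomial (Fin 4) K) :
    coords (A * B) F = coords B (coords A F) := by
  simp only [coords, comp_aeval_apply]
  refine congrArg (aeval · F) (funext fun i => ?_)
  simp only [map_sum, map_mul, aeval_X, algHom_C, algebraMap_eq, Units.val_mul, Matrix.mul_apply,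
    Finset.sum_mul, Finset.mul_sum, mul_assoc]
  exact Finset.sum_comm

theorem eval_pderiv_coords (A : GL (Fin 4) K) (F : MvPolynomial (Fin 4) K) (v : Fin 4 → K) :
    (fun i => eval v (pderiv i (coords A F))) =
      A.val.transpose.mulVec fun i => eval (A.val.mulVec v) (pderiv i F) := by
  classical
  ext i
  rw [coords, pderiv_aeval, map_sum, Matrix.mulVec, dotProduct]
  refine Finset.sum_congr rfl fun j _ => ?_
  have h : eval v (pderiv i (∑ k, C (A.val j k) * X k)) = A.val j i := by
    simp [pderiv_X, Pi.single_apply, mul_ite]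
  rw [map_mul, h, mul_comm, ← eval_coords]
  rfl

end LinearSubstitution

section SingularVectors

open MvPolynomial

variable {K : Type*} [Field K]

theorem mulVec_injective (A : GL (Fin 4) K) : Function.Injective A.val.mulVec :=
  Matrix.mulVec_injective_of_isUnit A.isUnit

theorem exists_mulVec_eq (A : GL (Fin 4) K) (w : Fin 4 → K) : ∃ v, A.val.mulVec v = w :=
  Matrix.mulVec_surjective_iff_isUnit.mpr A.isUnit w

theorem mulVec_ne_zero (A : GL (Fin 4) K) {v : Fin 4 → K} (hv : v ≠ 0) :
    A.val.mulVec v ≠ 0 := fun h =>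
  hv (mulVec_injective A (h.trans (Matrix.mulVec_zero _).symm))

/-- The form `F` and its gradient vanish at the vector `v`, so that `v`, if nonzero, represents a
singular point of the surface `F = 0`. -/
def IsSingularVector (F : MvPolynomial (Fin 4) K) (v : Fin 4 → K) : Prop :=
  eval v F = 0 ∧ ∀ i, eval v (pderiv i F) = 0

theorem isSingularVector_of_pderiv {F : MvPolynomial (Fin 4) K} {n : ℕ} (hF : F.IsHomogeneous n)
    (hn : (n : K) ≠ 0) {v : Fin 4 → K} (hv : ∀ i, eval v (pderiv i F) = 0) :
    IsSingularVector F v := by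
  have euler := congrArg (eval v) hF.sum_X_mul_pderiv
  simp only [map_sum, map_mul, hv, mul_zero, Finset.sum_const_zero, nsmul_eq_mul,
    map_natCast] at euler
  exact ⟨(mul_eq_zero.mp euler.symm).resolve_left hn, hv⟩

theorem IsSingularVector.smul {F : MvPolynomial (Fin 4) K} {n : ℕ} (hF : F.IsHomogeneous n)
    {v : Fin 4 → K} (hv : IsSingularVector F v) (a : K) : IsSingularVector F (a • v) :=
  ⟨by rw [eval_smul_of_isHomogeneous hF, hv.1, mul_zero],
    fun i => by rw [eval_smul_of_isHomogeneous hF.pderiv, hv.2 i, mul_zero]⟩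

theorem isSingularVector_coords {A : GL (Fin 4) K} {F : MvPolynomial (Fin 4) K}
    {v : Fin 4 → K} : IsSingularVector (coords A F) v ↔ IsSingularVector F (A.val.mulVec v) := by
  have hA : Function.Injective A.val.transpose.mulVec :=
    Matrix.mulVec_injective_of_isUnit (by simp)
  simp only [IsSingularVector, eval_coords, and_congr_right_iff]
  refine fun _ => ?_
  rw [← funext_iff (g := fun _ => (0 : K)), ← funext_iff (g := fun _ => (0 : K)),
    eval_pderiv_coords]
  exact hA.eq_iff' (Matrix.mulVec_zero _)

theorem mem_singularPoints_iff {F : MvPolynomial (Fin 4) K} {n : ℕ} (hF : F.IsHomogeneous n)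
    {v : Fin 4 → K} (hv : v ≠ 0) : .mk K v hv ∈ singularPoints F ↔ IsSingularVector F v := by
  obtain ⟨a, ha⟩ := Projectivization.exists_smul_eq_mk_rep K v hv
  change IsSingularVector F (Projectivization.mk K v hv).rep ↔ _
  rw [← ha]
  refine ⟨fun h => ?_, fun h => h.smul hF (a : K)⟩
  simpa only [smul_smul, one_smul, Units.smul_def, Units.inv_mul] using
    h.smul hF (a⁻¹ : Kˣ)

theorem infinite_singularPoints {ι : Type*} [Infinite ι] {F : MvPolynomial (Fin 4) K} {n : ℕ}
    (hF : F.IsHomogeneous n) (A : GL (Fin 4) K) {v : ι → Fin 4 → K} (hv : ∀ i, v i ≠ 0)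
    (hinj : ∀ i j (a : K), a • v i = v j → i = j)
    (hsing : ∀ i, IsSingularVector (coords A F) (v i)) : (singularPoints F).Infinite := by
  refine (Set.infinite_range_of_injective (f := fun i => Projectivization.mk K _
    (mulVec_ne_zero A (hv i))) fun i j hij => ?_).mono ?_
  · obtain ⟨a, ha⟩ := (Projectivization.mk_eq_mk_iff' K _ _ _ _).mp hij
    rw [← Matrix.mulVec_smul] at ha
    exact (hinj j i a (mulVec_injective A ha)).symm
  · rintro _ ⟨i, rfl⟩
    exact (mem_singularPoints_iff hF _).mpr (isSingularVector_coords.mp (hsing i))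

end SingularVectors

section Wronskian

open Polynomial IntermediateField

theorem isSeparable_of_aeval_derivative_ne_zero {F E : Type*} [Field F] [Field E] [Algebra F E]
    {x : E} {f : F[X]} (hf : aeval x f = 0) (hf' : aeval x (derivative f) ≠ 0) :
    IsSeparable F x := by
  have hf0 : f ≠ 0 := by
    rintro rfl
    simp at hf'
  have hintegral : IsIntegral F x := isAlgebraic_iff_isIntegral.mp ⟨f, hf0, hf⟩
  rw [IsSeparable, separable_iff_derivative_ne_zero (minpoly.irreducible hintegral)]
  intro h
  obtain ⟨q, rfl⟩ := minpoly.dvd F x hf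
  exact hf' (by simp [derivative_mul, h])

variable {K : Type*} [Field K]

theorem isSeparable_ratFunc_of_isSeparable_X {E : IntermediateField K (RatFunc K)}
    (hX : IsSeparable E (RatFunc.X : RatFunc K)) : Algebra.IsSeparable E (RatFunc K) := by
  have h := (isSeparable_adjoin_simple_iff_isSeparable E (RatFunc K)).mpr hX
  rw [RatFunc.IntermediateField.adjoin_X] at h
  exact Algebra.IsSeparable.of_algHom E _ (topEquiv.symm : RatFunc K ≃ₐ[E] _).toAlgHom

theorem isSeparable_adjoin_div_of_wronskian_ne_zero {α β : K[X]} (hW : wronskian α β ≠ 0) :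
    Algebra.IsSeparable
      K⟮-(algebraMap K[X] (RatFunc K) β) / algebraMap K[X] (RatFunc K) α⟯ (RatFunc K) := by
  set t : RatFunc K := -(algebraMap K[X] (RatFunc K) β) / algebraMap K[X] (RatFunc K) α
  have hα : algebraMap K[X] (RatFunc K) α ≠ 0 := fun h =>
    hW (by rw [(map_eq_zero_iff _ (RatFunc.algebraMap_injective K)).mp h, wronskian_zero_left])
  have htα : t * algebraMap K[X] (RatFunc K) α = -(algebraMap K[X] (RatFunc K) β) :=
    div_mul_cancel₀ _ hα
  have aeval_X (q : K[X]) : aeval (RatFunc.X : RatFunc K) (q.map (algebraMap K K⟮t⟯)) =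
      algebraMap K[X] (RatFunc K) q := by
    rw [aeval_map_algebraMap, RatFunc.aeval_X_left_eq_algebraMap]
  refine isSeparable_ratFunc_of_isSeparable_X (isSeparable_of_aeval_derivative_ne_zero
    (f := C (AdjoinSimple.gen K t) * α.map (algebraMap K K⟮t⟯) + β.map (algebraMap K K⟮t⟯))
    ?_ fun h => hW ?_)
  · simp only [map_add, map_mul, aeval_X, aeval_C, AdjoinSimple.algebraMap_gen]
    rw [htα, neg_add_cancel]
  · simp only [derivative_mul, derivative_C, zero_mul, zero_add, derivative_map, map_add, map_mul,
      aeval_X, aeval_C, AdjoinSimple.algebraMap_gen] at h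
    refine FaithfulSMul.algebraMap_injective K[X] (RatFunc K) ?_
    simp only [wronskian, map_sub, map_mul, map_zero]
    linear_combination algebraMap K[X] (RatFunc K) α * h
      - algebraMap K[X] (RatFunc K) (derivative α) * htα

theorem linearIndependent_of_div_notMem_range {α β : K[X]}
    (h : -(algebraMap K[X] (RatFunc K) β) / algebraMap K[X] (RatFunc K) α ∉
      Set.range (algebraMap K (RatFunc K))) : LinearIndependent K ![α, β] := by
  have hα : α ≠ 0 := by
    rintro rfl
    exact h ⟨0, by simp⟩
  refine (LinearIndependent.pair_iff' hα).mpr fun a ha => h ⟨-a, ?_⟩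
  have hα' : algebraMap K[X] (RatFunc K) α ≠ 0 := RatFunc.algebraMap_ne_zero hα
  rw [← ha, smul_eq_C_mul, map_mul, eq_div_iff hα', map_neg, neg_mul]
  rfl

theorem natDegree_eq_zero_or_le_of_derivative_eq_zero {p : ℕ} [CharP K p] (hp : p ≠ 0) {f : K[X]}
    (hf : derivative f = 0) : f.natDegree = 0 ∨ p ≤ f.natDegree := by
  rw [← expand_contract p hf hp, natDegree_expand]
  rcases Nat.eq_zero_or_pos (contract p f).natDegree with h | h
  · exact .inl (by rw [h, zero_mul])
  · exact .inr (Nat.le_mul_of_pos_left p h)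

theorem derivative_eq_zero_of_wronskian_eq_zero {p : ℕ} [CharP K p] (hp : p ≠ 0) {α β : K[X]}
    (hα : α.natDegree ≤ p) (hβ : β.natDegree ≤ p) (hlin : LinearIndependent K ![α, β])
    (hW : wronskian α β = 0) : derivative α = 0 ∧ derivative β = 0 := by
  have hα0 : α ≠ 0 := hlin.ne_zero 0
  have hβ0 : β ≠ 0 := hlin.ne_zero 1
  obtain ⟨g, a, b, hab, rfl, rfl⟩ : ∃ g a b, IsCoprime a b ∧ α = g * a ∧ β = g * b := by
    classical
    exact ⟨_, _, _, isCoprime_div_gcd_div_gcd hβ0,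
      (EuclideanDomain.mul_div_cancel' (gcd_ne_zero_of_left hα0) (gcd_dvd_left α β)).symm,
      (EuclideanDomain.mul_div_cancel' (gcd_ne_zero_of_left hα0) (gcd_dvd_right α β)).symm⟩
  obtain ⟨hg, ha⟩ := mul_ne_zero_iff.mp hα0
  have hb := right_ne_zero_of_mul hβ0
  have hW' : wronskian a b = 0 := by
    refine (mul_eq_zero.mp ?_).resolve_left (pow_ne_zero 2 hg)
    rw [← hW]
    simp only [wronskian, derivative_mul]
    ring
  obtain ⟨ha', hb'⟩ := hab.wronskian_eq_zero_iff.mp hW'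
  suffices hg' : derivative g = 0 by simp [derivative_mul, ha', hb', hg']
  rw [natDegree_mul hg ha] at hα
  rw [natDegree_mul hg hb] at hβ
  suffices g.natDegree = 0 by rw [eq_C_of_natDegree_eq_zero this, derivative_C]
  by_contra hg0
  have ha0 : a.natDegree = 0 :=
    (natDegree_eq_zero_or_le_of_derivative_eq_zero hp ha').resolve_right (by omega)
  have hb0 : b.natDegree = 0 :=
    (natDegree_eq_zero_or_le_of_derivative_eq_zero hp hb').resolve_right (by omega)
  rw [eq_C_of_natDegree_eq_zero ha0, eq_C_of_natDegree_eq_zero hb0] at hlin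
  have := LinearIndependent.pair_iff.mp hlin (b.coeff 0) (-a.coeff 0) (by
    simp only [smul_eq_C_mul, C_neg]
    ring)
  rw [eq_C_of_natDegree_eq_zero hb0, this.1, C_0] at hb
  exact hb rfl

end Wronskian

section Expand

open Polynomial

variable {R : Type*} [CommSemiring R]

theorem coeff_sum_X_pow_mul_expand {n p : ℕ} (hnp : n ≤ p) (f : Fin n → R[X]) (i : ℕ) (k : Fin n) :
    (∑ j : Fin n, X ^ (j : ℕ) * expand R p (f j)).coeff (p * i + k) = (f k).coeff i := by
  have hp : 0 < p := k.pos.trans_le hnp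
  rw [finsetSum_coeff, Finset.sum_eq_single k]
  · rw [coeff_X_pow_mul, coeff_expand_mul' hp]
  · intro j _ hjk
    rw [coeff_X_pow_mul', coeff_expand hp]
    split_ifs with hle hdvd
    · refine absurd (Fin.ext ?_) hjk
      have h : (p * i + k) % p = j % p := ((Nat.modEq_iff_dvd' hle).mpr hdvd).symm
      rwa [Nat.mul_add_mod, Nat.mod_eq_of_lt (by omega), Nat.mod_eq_of_lt (by omega), eq_comm] at h
    all_goals rfl
  · exact fun h => absurd (Finset.mem_univ k) h

theorem eq_zero_of_sum_X_pow_mul_expand_eq_zero {n p : ℕ} (hnp : n ≤ p) {f : Fin n → R[X]}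
    (h : ∑ j : Fin n, X ^ (j : ℕ) * expand R p (f j) = 0) (k : Fin n) : f k = 0 := by
  ext i
  rw [← coeff_sum_X_pow_mul_expand hnp, h, coeff_zero, coeff_zero]

end Expand

section BinaryForms

open Polynomial

variable {K : Type*} [Field K]

/-- The binary form `f(x₀, x₁)` dehomogenised to the polynomial `f(X, 1)`. -/
noncomputable def dehomogenize (f : MvPolynomial (Fin 2) K) : K[X] :=
  MvPolynomial.aeval ![X, 1] f

theorem eval_dehomogenize (t : K) (f : MvPolynomial (Fin 2) K) :
    (dehomogenize f).eval t = MvPolynomial.eval ![t, 1] f := by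
  rw [dehomogenize, ← coe_aeval_eq_eval, MvPolynomial.comp_aeval_apply,
    ← MvPolynomial.coe_aeval_eq_eval]
  exact congrArg (MvPolynomial.aeval · f) (funext (Fin.forall_fin_two.mpr (by simp)))

variable {f : MvPolynomial (Fin 2) K} {n : ℕ}

theorem natDegree_dehomogenize_le (hf : f.IsHomogeneous n) : (dehomogenize f).natDegree ≤ n := by
  rw [dehomogenize, f.as_sum, map_sum]
  refine natDegree_sum_le_of_forall_le _ _ fun d hd => ?_
  have hdn : d 0 + d 1 = n := by
    rw [hf.degree_eq_sum_deg_support hd, ← Fin.sum_univ_two, ← Finsupp.degree_eq_sum]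
    rfl
  rw [MvPolynomial.aeval_monomial, Finsupp.prod_fintype _ _ (by simp), Fin.prod_univ_two]
  simpa using (natDegree_C_mul_X_pow_le (f.coeff d) (d 0)).trans (by omega : d 0 ≤ n)

theorem coeff_dehomogenize (hf : f.IsHomogeneous n) :
    (dehomogenize f).coeff n = MvPolynomial.eval ![1, 0] f := by
  conv_rhs => rw [← homogenize_eq_of_isHomogeneous hf rfl, homogenize, map_sum]
  rw [Finset.sum_eq_single_of_mem (n, 0) (by simp)]
  · simp [MvPolynomial.eval_monomial, dehomogenize]
  · intro ij hij hne
    have : ij.2 ≠ 0 := fun h => hne (Prod.ext (by simpa [h] using hij) h)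
    simp [MvPolynomial.eval_monomial, this]

theorem eq_zero_of_dehomogenize_eq_zero (hf : f.IsHomogeneous n) (h : dehomogenize f = 0) :
    f = 0 := by
  rw [← homogenize_eq_of_isHomogeneous hf h, homogenize_zero]

end BinaryForms

section Expansion

open MvPolynomial

variable {K : Type*} [Field K]

theorem aeval_rename_fin_two {S : Type*} [CommRing S] [Algebra K S] (v : Fin 4 → S)
    (f : MvPolynomial (Fin 2) K) : aeval v (rename ![0, 1] f) = aeval ![v 0, v 1] f := by
  rw [aeval_rename]
  exact congrArg (aeval · f) (funext (Fin.forall_fin_two.mpr ⟨rfl, rfl⟩))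

theorem eval_rename_fin_two (v : Fin 4 → K) (f : MvPolynomial (Fin 2) K) :
    eval v (rename ![0, 1] f) = eval ![v 0, v 1] f :=
  aeval_rename_fin_two v f

theorem aeval_zero_zero_of_isHomogeneous {S : Type*} [CommRing S] [Algebra K S]
    {f : MvPolynomial (Fin 2) K} {n : ℕ} (hf : f.IsHomogeneous n) (hn : n ≠ 0) :
    aeval (![0, 0] : Fin 2 → S) f = 0 := by
  have h : (![0, 0] : Fin 2 → S) = fun _ => 0 * 0 := funext (Fin.forall_fin_two.mpr (by simp))
  rw [h, aeval_mul_left_of_isHomogeneous hf, zero_pow hn, zero_mul]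

theorem exists_eq_sum_rename_mul {G : MvPolynomial (Fin 4) K} {n : ℕ} (hG : G.IsHomogeneous n) :
    ∃ f : ℕ → ℕ → MvPolynomial (Fin 2) K, (∀ i j, (f i j).IsHomogeneous i) ∧
      G = ∑ i ∈ Finset.range (n + 1), ∑ j ∈ Finset.range (n + 1 - i),
        rename ![0, 1] (f i j) * X 2 ^ j * X 3 ^ (n - i - j) := by
  have degree {d : Fin 4 →₀ ℕ} (hd : d ∈ G.support) : d 0 + d 1 + d 2 + d 3 = n := by
    rw [hG.degree_eq_sum_deg_support hd, ← Fin.sum_univ_four, ← Finsupp.degree_eq_sum]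
    rfl
  refine ⟨fun i j => ∑ d ∈ G.support with (⟨d 0 + d 1, d 2⟩ : (_ : ℕ) × ℕ) = ⟨i, j⟩,
    C (coeff d G) * (X 0 ^ d 0 * X 1 ^ d 1), fun i j => IsHomogeneous.sum _ _ _ fun d hd => ?_, ?_⟩
  · obtain ⟨rfl, -⟩ := Sigma.mk.inj (Finset.mem_filter.mp hd).2
    exact ((isHomogeneous_X_pow 0 _).mul (isHomogeneous_X_pow 1 _)).C_mul _
  conv_lhs => rw [G.as_sum, ← Finset.sum_fiberwise_of_maps_to
    (t := (Finset.range (n + 1)).sigma fun i => Finset.range (n + 1 - i))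
    (g := fun d => (⟨d 0 + d 1, d 2⟩ : (_ : ℕ) × ℕ)) (fun d hd => by
      have := degree hd
      simp only [Finset.mem_sigma, Finset.mem_range]
      omega)]
  rw [Finset.sum_sigma]
  refine Finset.sum_congr rfl fun i _ => Finset.sum_congr rfl fun j _ => ?_
  rw [map_sum, Finset.sum_mul, Finset.sum_mul]
  refine Finset.sum_congr rfl fun d hd => ?_
  obtain ⟨hdG, hij⟩ := Finset.mem_filter.mp hd
  obtain ⟨rfl, hj⟩ := Sigma.mk.inj hij
  have h3 : n - (d 0 + d 1) - j = d 3 := by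
    have := degree hdG
    have := eq_of_heq hj
    omega
  rw [h3, ← eq_of_heq hj, monomial_eq, Finsupp.prod_fintype _ _ fun _ => pow_zero _,
    Fin.prod_univ_four]
  simp only [map_mul, map_pow, rename_C, rename_X, Matrix.cons_val_zero, Matrix.cons_val_one,
    mul_assoc]

/-- The data of a quartic form vanishing on the line `x₀ = x₁ = 0`, sorted by the degree in
`x₀, x₁`: the row `l j` lists the coefficients of `x₀` and `x₁` in the linear form multiplying
`x₂^j x₃^(3-j)`, and the forms `q j`, `r j` and `m` in `x₀, x₁` multiply `x₂^j x₃^(2-j)`,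
`x₂^j x₃^(1-j)` and `1`. -/
structure LineExpansion (K : Type*) [Field K] where
  l : Matrix (Fin 4) (Fin 2) K
  q : Fin 3 → MvPolynomial (Fin 2) K
  r : Fin 2 → MvPolynomial (Fin 2) K
  m : MvPolynomial (Fin 2) K
  isHomogeneous_q : ∀ j, (q j).IsHomogeneous 2
  isHomogeneous_r : ∀ j, (r j).IsHomogeneous 3
  isHomogeneous_m : m.IsHomogeneous 4

namespace LineExpansion

/-- The quartic form with a given expansion along the line `x₀ = x₁ = 0`. -/
noncomputable def quartic (c : LineExpansion K) : MvPolynomial (Fin 4) K :=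
  ∑ j : Fin 4, (C (c.l j 0) * X 0 + C (c.l j 1) * X 1) * X 2 ^ (j : ℕ) * X 3 ^ (3 - j : ℕ) +
    ∑ j : Fin 3, rename ![0, 1] (c.q j) * X 2 ^ (j : ℕ) * X 3 ^ (2 - j : ℕ) +
    ∑ j : Fin 2, rename ![0, 1] (c.r j) * X 2 ^ (j : ℕ) * X 3 ^ (1 - j : ℕ) +
    rename ![0, 1] c.m

theorem aeval_quartic {S : Type*} [CommRing S] [Algebra K S] (c : LineExpansion K)
    (v : Fin 4 → S) : aeval v c.quartic =
      ∑ j : Fin 4, (algebraMap K S (c.l j 0) * v 0 + algebraMap K S (c.l j 1) * v 1) *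
        v 2 ^ (j : ℕ) * v 3 ^ (3 - j : ℕ) +
      ∑ j : Fin 3, aeval ![v 0, v 1] (c.q j) * v 2 ^ (j : ℕ) * v 3 ^ (2 - j : ℕ) +
      ∑ j : Fin 2, aeval ![v 0, v 1] (c.r j) * v 2 ^ (j : ℕ) * v 3 ^ (1 - j : ℕ) +
      aeval ![v 0, v 1] c.m := by
  simp only [quartic, map_add, map_sum, map_mul, map_pow, aeval_rename_fin_two, aeval_X, aeval_C]

theorem eval_quartic (c : LineExpansion K) (v : Fin 4 → K) : eval v c.quartic =
    ∑ j : Fin 4, (c.l j 0 * v 0 + c.l j 1 * v 1) * v 2 ^ (j : ℕ) * v 3 ^ (3 - j : ℕ) +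
      ∑ j : Fin 3, eval ![v 0, v 1] (c.q j) * v 2 ^ (j : ℕ) * v 3 ^ (2 - j : ℕ) +
      ∑ j : Fin 2, eval ![v 0, v 1] (c.r j) * v 2 ^ (j : ℕ) * v 3 ^ (1 - j : ℕ) +
      eval ![v 0, v 1] c.m :=
  c.aeval_quartic v

end LineExpansion

theorem exists_quartic_eq [Infinite K] {G : MvPolynomial (Fin 4) K} (hG : G.IsHomogeneous 4)
    (hline : ∀ u, eval ![0, 0, u, 1] G = 0) : ∃ c : LineExpansion K, c.quartic = G := by
  obtain ⟨f, hf, hGf⟩ := exists_eq_sum_rename_mul hG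
  have hf1 (j) : ∃ a : Fin 2 → K, f 1 j = C (a 0) * X 0 + C (a 1) * X 1 := by
    have h := (mem_homogeneousSubmodule 1 _).mpr (hf 1 j)
    rw [homogeneousSubmodule_one_eq_span_X, Submodule.mem_span_range_iff_exists_fun] at h
    obtain ⟨a, ha⟩ := h
    exact ⟨a, by rw [← ha, Fin.sum_univ_two, smul_eq_C_mul, smul_eq_C_mul]⟩
  have hf0 (j) : ∃ a : K, f 0 j = C a := by
    have h := hf 0 j
    rw [← mem_homogeneousSubmodule, homogeneousSubmodule_zero, Submodule.mem_one] at h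
    exact h.imp fun _ => Eq.symm
  choose a ha using hf1
  choose b hb using hf0
  have hvanish : ∑ j ∈ Finset.range 5, Polynomial.C (b j) * Polynomial.X ^ j = 0 := by
    refine Polynomial.funext fun u => ?_
    have h := hline u
    rw [hGf, map_sum, Finset.sum_eq_single_of_mem 0 (Finset.mem_range.mpr (Nat.succ_pos 4))] at h
    · rw [Polynomial.eval_zero]
      refine Eq.trans ?_ h
      simp [Polynomial.eval_finsetSum, hb]
    · refine fun i _ hi => (map_sum _ _ _).trans (Finset.sum_eq_zero fun j _ => ?_)
      have hzero : eval ![0, 0, u, 1] (rename ![0, 1] (f i j)) = 0 :=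
        (eval_rename_fin_two _ _).trans (aeval_zero_zero_of_isHomogeneous (hf i j) hi)
      rw [map_mul, map_mul, hzero, zero_mul, zero_mul]
  have hb0 (j) (hj : j ∈ Finset.range 5) : b j = 0 := by
    have h := congrArg (Polynomial.coeff · j) hvanish
    simpa [Polynomial.finsetSum_coeff, Polynomial.coeff_C_mul, Polynomial.coeff_X_pow, hj] using h
  refine ⟨⟨fun j => a j, fun j => f 2 j, fun j => f 3 j, f 4 0, fun _ => hf _ _, fun _ => hf _ _,
    hf _ _⟩, ?_⟩
  rw [hGf, LineExpansion.quartic]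
  simp only [Finset.sum_range_succ, Finset.sum_range_zero, Fin.sum_univ_four, Fin.sum_univ_three,
    Fin.sum_univ_two, ha, hb, hb0 _ (Finset.mem_range.mpr _), Nat.reduceLT, map_zero, zero_mul,
    Fin.coe_ofNat_eq_mod, Nat.reduceMod, map_add, map_mul, rename_X, rename_C,
    Matrix.cons_val_zero, Matrix.cons_val_one]
  ring

end Expansion

section Gradient

open MvPolynomial

variable {K : Type*} [Field K]

theorem pderiv_rename_fin_two (k : Fin 2) (f : MvPolynomial (Fin 2) K) :
    pderiv (![0, 1] k) (rename (![0, 1] : Fin 2 → Fin 4) f) =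
      rename ![0, 1] (pderiv k f) :=
  pderiv_rename (by decide) k f

theorem pderiv_rename_fin_two_eq_zero {i : Fin 4} (hi : i ∉ Set.range ![0, 1])
    (f : MvPolynomial (Fin 2) K) : pderiv i (rename (![0, 1] : Fin 2 → Fin 4) f) = 0 := by
  classical
  exact pderiv_eq_zero_of_notMem_vars fun h => hi <| by
    obtain ⟨k, -, hk⟩ := Finset.mem_image.mp (vars_rename _ f h)
    exact ⟨k, hk⟩

namespace LineExpansion

theorem aeval_pderiv_quartic {S : Type*} [CommRing S] [Algebra K S] (c : LineExpansion K)
    (v : Fin 4 → S) (k : Fin 2) : aeval v (pderiv (![0, 1] k) c.quartic) =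
      ∑ j : Fin 4, algebraMap K S (c.l j k) * v 2 ^ (j : ℕ) * v 3 ^ (3 - j : ℕ) +
      ∑ j : Fin 3, aeval ![v 0, v 1] (pderiv k (c.q j)) * v 2 ^ (j : ℕ) * v 3 ^ (2 - j : ℕ) +
      ∑ j : Fin 2, aeval ![v 0, v 1] (pderiv k (c.r j)) * v 2 ^ (j : ℕ) * v 3 ^ (1 - j : ℕ) +
      aeval ![v 0, v 1] (pderiv k c.m) := by
  have h2 : pderiv (![0, 1] k) (X 2 : MvPolynomial (Fin 4) K) = 0 := by
    fin_cases k <;> exact pderiv_X_of_ne (by decide)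
  have h3 : pderiv (![0, 1] k) (X 3 : MvPolynomial (Fin 4) K) = 0 := by
    fin_cases k <;> exact pderiv_X_of_ne (by decide)
  have hl (a b : K) : pderiv (![0, 1] k) (C a * X 0 + C b * X 1 : MvPolynomial (Fin 4) K) =
      C (![a, b] k) := by
    fin_cases k <;> simp [pderiv_X]
  have hlk (j) : ![c.l j 0, c.l j 1] k = c.l j k := by
    fin_cases k <;> rfl
  simp only [quartic, map_add, map_sum, Derivation.leibniz, Derivation.leibniz_pow, h2, h3, hl, hlk,
    pderiv_rename_fin_two, smul_eq_mul, smul_zero, mul_zero, zero_add, map_mul, map_pow, aeval_X,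
    aeval_C, aeval_rename_fin_two]
  simp only [mul_comm, mul_left_comm]

theorem pderiv_quartic_of_notMem_range (c : LineExpansion K) {i : Fin 4}
    (hi : i ∉ Set.range ![0, 1]) : pderiv i c.quartic =
      ∑ j : Fin 4, (C (c.l j 0) * X 0 + C (c.l j 1) * X 1) *
        pderiv i (X 2 ^ (j : ℕ) * X 3 ^ (3 - j : ℕ)) +
      ∑ j : Fin 3, rename ![0, 1] (c.q j) * pderiv i (X 2 ^ (j : ℕ) * X 3 ^ (2 - j : ℕ)) +
      ∑ j : Fin 2, rename ![0, 1] (c.r j) * pderiv i (X 2 ^ (j : ℕ) * X 3 ^ (1 - j : ℕ)) := by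
  have hmul {a : MvPolynomial (Fin 4) K} (ha : pderiv i a = 0) (b) :
      pderiv i (a * b) = a * pderiv i b := by
    rw [Derivation.leibniz, ha, smul_zero, add_zero, smul_eq_mul]
  have h0 : pderiv i (X 0 : MvPolynomial (Fin 4) K) = 0 := pderiv_X_of_ne fun h => hi ⟨0, h⟩
  have h1 : pderiv i (X 1 : MvPolynomial (Fin 4) K) = 0 := pderiv_X_of_ne fun h => hi ⟨1, h⟩
  have hl (a b : K) : pderiv i (C a * X 0 + C b * X 1 : MvPolynomial (Fin 4) K) = 0 := by
    rw [map_add, hmul (pderiv_C ..), hmul (pderiv_C ..), h0, h1, mul_zero, mul_zero, add_zero]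
  simp only [quartic, mul_assoc, map_add, map_sum, hmul (hl _ _),
    hmul (pderiv_rename_fin_two_eq_zero hi _), pderiv_rename_fin_two_eq_zero hi, add_zero]

theorem eval_pderiv_quartic_eq_zero (c : LineExpansion K) {v : Fin 4 → K} (h0 : v 0 = 0)
    (h1 : v 1 = 0) {i : Fin 4} (hi : i ∉ Set.range ![0, 1]) :
    eval v (pderiv i c.quartic) = 0 := by
  have hform {f : MvPolynomial (Fin 2) K} {n : ℕ} (hf : f.IsHomogeneous n) (hn : n ≠ 0) :
      eval v (rename ![0, 1] f) = 0 := by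
    rw [eval_rename_fin_two, h0, h1]
    exact aeval_zero_zero_of_isHomogeneous hf hn
  simp only [c.pderiv_quartic_of_notMem_range hi, map_add, map_sum, map_mul, eval_X, h0, h1,
    hform (c.isHomogeneous_q _) two_ne_zero, hform (c.isHomogeneous_r _) three_ne_zero, mul_zero,
    zero_mul, add_zero, Finset.sum_const_zero]

theorem aeval_pderiv_quartic_line {S : Type*} [CommRing S] [Algebra K S] (c : LineExpansion K)
    (k : Fin 2) (s : S) : aeval ![0, 0, s, 1] (pderiv (![0, 1] k) c.quartic) =
      ∑ j : Fin 4, algebraMap K S (c.l j k) * s ^ (j : ℕ) := by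
  rw [aeval_pderiv_quartic]
  change ∑ j : Fin 4, algebraMap K S (c.l j k) * s ^ (j : ℕ) * 1 ^ (3 - j : ℕ) +
      ∑ j : Fin 3, aeval ![0, 0] (pderiv k (c.q j)) * s ^ (j : ℕ) * 1 ^ (2 - j : ℕ) +
      ∑ j : Fin 2, aeval ![0, 0] (pderiv k (c.r j)) * s ^ (j : ℕ) * 1 ^ (1 - j : ℕ) +
      aeval ![0, 0] (pderiv k c.m) = _
  simp only [aeval_zero_zero_of_isHomogeneous (c.isHomogeneous_q _).pderiv one_ne_zero,
    aeval_zero_zero_of_isHomogeneous (c.isHomogeneous_r _).pderiv two_ne_zero,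
    aeval_zero_zero_of_isHomogeneous c.isHomogeneous_m.pderiv three_ne_zero, one_pow, mul_one,
    zero_mul, add_zero, Finset.sum_const_zero]

/-- The derivative `∂/∂xₖ` of the quartic along the line `x₀ = x₁ = 0`, in the affine coordinate
`x₂ / x₃` of the line. These are the polynomials `α` (`k = 0`) and `β` (`k = 1`) of the paper. -/
noncomputable def normalPoly (c : LineExpansion K) (k : Fin 2) : Polynomial K :=
  ∑ j : Fin 4, Polynomial.C (c.l j k) * Polynomial.X ^ (j : ℕ)

theorem normalDerivative_quartic (c : LineExpansion K) (k : Fin 2) :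
    normalDerivative (![0, 1] k) c.quartic = c.normalPoly k :=
  c.aeval_pderiv_quartic_line k Polynomial.X

theorem eval_pderiv_quartic_line (c : LineExpansion K) (k : Fin 2) (s : K) :
    eval ![0, 0, s, 1] (pderiv (![0, 1] k) c.quartic) = (c.normalPoly k).eval s := by
  refine (c.aeval_pderiv_quartic_line k s).trans ?_
  simp [normalPoly, Polynomial.eval_finsetSum]

theorem coeff_normalPoly (c : LineExpansion K) (k : Fin 2) (j : Fin 4) :
    (c.normalPoly k).coeff j = c.l j k := by
  simp [normalPoly, Polynomial.finsetSum_coeff, Polynomial.coeff_X_pow, Fin.val_inj]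

theorem natDegree_normalPoly_le (c : LineExpansion K) (k : Fin 2) :
    (c.normalPoly k).natDegree ≤ 3 :=
  Polynomial.natDegree_sum_le_of_forall_le _ _ fun j _ =>
    (Polynomial.natDegree_C_mul_X_pow_le _ _).trans (Nat.le_of_lt_succ j.isLt)

theorem isSingularVector_quartic_line (c : LineExpansion K) {s : K}
    (h : ∀ k, (c.normalPoly k).eval s = 0) : IsSingularVector c.quartic ![0, 0, s, 1] := by
  have hform {f : MvPolynomial (Fin 2) K} {n : ℕ} (hf : f.IsHomogeneous n) (hn : n ≠ 0) :
      eval ![0, 0] f = 0 := aeval_zero_zero_of_isHomogeneous hf hn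
  refine ⟨?_, fun i => ?_⟩
  · rw [eval_quartic]
    change _ + ∑ j : Fin 3, eval ![0, 0] (c.q j) * _ * _ +
      ∑ j : Fin 2, eval ![0, 0] (c.r j) * _ * _ + eval ![0, 0] c.m = 0
    simp [hform (c.isHomogeneous_q _), hform (c.isHomogeneous_r _), hform c.isHomogeneous_m]
  · by_cases hi : i ∈ Set.range ![0, 1]
    · obtain ⟨k, rfl⟩ := hi
      rw [eval_pderiv_quartic_line, h]
    · exact c.eval_pderiv_quartic_eq_zero rfl rfl hi

end LineExpansion

end Gradient

section PencilChange

open MvPolynomial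

variable {K : Type*} [Field K]

/-- The binary form `f(g x)` obtained from `f` by a linear change of the variables `x₀, x₁`. -/
noncomputable def binaryCoords (g : GL (Fin 2) K) (f : MvPolynomial (Fin 2) K) :
    MvPolynomial (Fin 2) K :=
  aeval (fun i => ∑ j, C (g i j) * X j) f

theorem isHomogeneous_binaryCoords (g : GL (Fin 2) K) {f : MvPolynomial (Fin 2) K} {n : ℕ}
    (hf : f.IsHomogeneous n) : (binaryCoords g f).IsHomogeneous n :=
  isHomogeneous_aeval_linear g.val hf

theorem eval_binaryCoords (g : GL (Fin 2) K) (f : MvPolynomial (Fin 2) K) (v : Fin 2 → K) :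
    eval v (binaryCoords g f) = eval (g.val.mulVec v) f :=
  eval_aeval_linear g.val f v

/-- The linear change of the coordinates `x₀, x₁` by `g` as a change of coordinates of `ℙ³`. It
preserves the line `x₀ = x₁ = 0` pointwise and acts on the pencil of planes containing it. -/
noncomputable def pencilChange (g : GL (Fin 2) K) : GL (Fin 4) K :=
  Matrix.GeneralLinearGroup.mkOfDetNeZero
    !![g 0 0, g 0 1, 0, 0; g 1 0, g 1 1, 0, 0; 0, 0, 1, 0; 0, 0, 0, 1] <| by
      have h := g.det_ne_zero
      rw [Matrix.det_fin_two] at h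
      simpa [Matrix.det_succ_row_zero, Fin.sum_univ_succ, Fin.succAbove, sub_eq_add_neg] using h

theorem pencilChange_mulVec (g : GL (Fin 2) K) (u v : K) :
    (pencilChange g).val.mulVec ![0, 0, u, v] = ![0, 0, u, v] := by
  ext i
  fin_cases i <;> simp [pencilChange, Matrix.GeneralLinearGroup.mkOfDetNeZero, Matrix.mulVec,
    dotProduct, Fin.sum_univ_four]

theorem IsAdapted.mul_pencilChange {A : GL (Fin 4) K} {ℓ : Submodule K (Fin 4 → K)}
    (hA : IsAdapted A ℓ) (g : GL (Fin 2) K) : IsAdapted (A * pencilChange g) ℓ := by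
  rw [IsAdapted, Units.val_mul, ← Matrix.mulVec_mulVec, ← Matrix.mulVec_mulVec,
    pencilChange_mulVec, pencilChange_mulVec]
  exact hA

namespace LineExpansion

/-- The expansion of the quartic form after the linear change `g` of the coordinates `x₀, x₁`. -/
noncomputable def comp (c : LineExpansion K) (g : GL (Fin 2) K) : LineExpansion K where
  l := c.l * g.val
  q j := binaryCoords g (c.q j)
  r j := binaryCoords g (c.r j)
  m := binaryCoords g c.m
  isHomogeneous_q j := isHomogeneous_binaryCoords g (c.isHomogeneous_q j)
  isHomogeneous_r j := isHomogeneous_binaryCoords g (c.isHomogeneous_r j)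
  isHomogeneous_m := isHomogeneous_binaryCoords g c.isHomogeneous_m

theorem coords_pencilChange_quartic (c : LineExpansion K) (g : GL (Fin 2) K) :
    coords (pencilChange g) c.quartic = (c.comp g).quartic := by
  have hbinary (f : MvPolynomial (Fin 2) K) :
      aeval ![C (g 0 0) * X 0 + C (g 0 1) * X 1, C (g 1 0) * X 0 + C (g 1 1) * X 1] f =
        rename (![0, 1] : Fin 2 → Fin 4) (binaryCoords g f) := by
    rw [binaryCoords, comp_aeval_apply]
    refine congrArg (aeval · f) (funext (Fin.forall_fin_two.mpr ⟨?_, ?_⟩)) <;>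
      simp [Fin.sum_univ_two, algebraMap_eq]
  have hsubst : (fun i => ∑ j, C ((pencilChange g).val i j) * X j : Fin 4 → MvPolynomial _ K) =
      ![C (g 0 0) * X 0 + C (g 0 1) * X 1, C (g 1 0) * X 0 + C (g 1 1) * X 1, X 2, X 3] := by
    ext1 i
    fin_cases i <;>
      simp [pencilChange, Matrix.GeneralLinearGroup.mkOfDetNeZero, Fin.sum_univ_four]
  rw [coords, hsubst, aeval_quartic, quartic]
  simp only [Matrix.cons_val, hbinary]
  refine congrArg₂ _ (congrArg₂ _ (congrArg₂ _ ?_ rfl) rfl) rfl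
  refine Finset.sum_congr rfl fun j _ => ?_
  simp only [comp, Matrix.mul_apply, Fin.sum_univ_two, algebraMap_eq, map_add, map_mul]
  ring

end LineExpansion

end PencilChange

section Adapted

open MvPolynomial

variable {K : Type*} [Field K] {A : GL (Fin 4) K} {ℓ : Submodule K (Fin 4 → K)}
  {F : MvPolynomial (Fin 4) K}

theorem IsAdapted.mulVec_mem_iff (hA : IsAdapted A ℓ) (v : Fin 4 → K) :
    A.val.mulVec v ∈ ℓ ↔ v 0 = 0 ∧ v 1 = 0 := by
  rw [show ℓ = _ from hA, Submodule.mem_span_pair]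
  simp only [← Matrix.mulVec_smul, ← Matrix.mulVec_add, (mulVec_injective A).eq_iff]
  constructor
  · rintro ⟨a, b, rfl⟩
    simp
  · rintro ⟨h0, h1⟩
    refine ⟨v 2, v 3, funext fun i => ?_⟩
    fin_cases i <;> simp [h0, h1]

theorem mem_points_iff {P : ℙ K (Fin 4 → K)} :
    P ∈ points ℓ ↔ P.rep ∈ ℓ := by
  change P.submodule ≤ ℓ ↔ _
  rw [P.submodule_eq, Submodule.span_singleton_le_iff_mem]

theorem IsAdapted.exists_mulVec_eq_rep (hA : IsAdapted A ℓ) {P : ℙ K (Fin 4 → K)}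
    (hP : P ∈ points ℓ) : ∃ u v, A.val.mulVec ![0, 0, u, v] = P.rep := by
  obtain ⟨w, hw⟩ := exists_mulVec_eq A P.rep
  rw [mem_points_iff, ← hw, hA.mulVec_mem_iff] at hP
  refine ⟨w 2, w 3, ?_⟩
  rw [← hw]
  congr 1
  ext i
  fin_cases i <;> simp [hP]

theorem IsAdapted.exists_coords_eq_quartic [Infinite K] (hA : IsAdapted A ℓ)
    (hF : F.IsHomogeneous 4) (hℓ : IsLineOn F ℓ) :
    ∃ c : LineExpansion K, coords A F = c.quartic := by
  obtain ⟨c, hc⟩ := exists_quartic_eq (isHomogeneous_coords A hF) fun u => by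
    rw [eval_coords]
    exact hℓ.eval_eq_zero _ ((hA.mulVec_mem_iff _).mpr ⟨rfl, rfl⟩)
  exact ⟨c, hc.symm⟩

theorem IsLineOn.comap {m : Submodule K (Fin 4 → K)} (hm : IsLineOn F m) (A : GL (Fin 4) K) :
    IsLineOn (coords A F) (m.comap A.val.mulVecLin) := by
  refine ⟨?_, fun v hv => ?_⟩
  · have h := (Submodule.equivMapOfInjective A.val.mulVecLin
      (mulVec_injective A) (m.comap A.val.mulVecLin)).finrank_eq
    rw [h, Submodule.map_comap_eq_of_surjective (exists_mulVec_eq A ·), hm.finrank_eq]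
  · rw [eval_coords]
    exact hm.eval_eq_zero _ hv

theorem finite_setOf_normalPoly_eval_eq_zero (hF : F.IsHomogeneous 4)
    (hsing : (singularPoints F).Finite) {c : LineExpansion K} (hc : coords A F = c.quartic) :
    {s | ∀ k, (c.normalPoly k).eval s = 0}.Finite := by
  by_contra hinf
  have := Set.infinite_coe_iff.mpr hinf
  refine infinite_singularPoints hF A
    (v := fun s : {s | ∀ k, (c.normalPoly k).eval s = 0} => ![0, 0, s.1, 1])
    (fun s h => one_ne_zero (congrFun h 3)) (fun s s' a h => Subtype.ext ?_)
    (fun s => hc ▸ c.isSingularVector_quartic_line s.2) hsing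
  have h2 : a * s = s' := congrFun h 2
  have h3 : a * 1 = 1 := congrFun h 3
  rwa [← mul_one a, h3, one_mul] at h2

end Adapted

section Normalization

open Polynomial

variable {K : Type*} [Field K]

/-- The coordinates `x₀, x₁` are normalised so that the expansion of the quartic form begins with
`x₀ x₃³ - x₁ x₂³`: the plane meeting the line residually at `[0 : 0 : s : 1]` is `x₀ = s³ x₁`. -/
def LineExpansion.IsNormalized (c : LineExpansion K) : Prop :=
  c.l = !![1, 0; 0, 0; 0, 0; 0, -1]

theorem LineExpansion.exists_isNormalized_comp [CharP K 3] {c : LineExpansion K}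
    (hlin : LinearIndependent K ![c.normalPoly 0, c.normalPoly 1])
    (hderiv : ∀ k, derivative (c.normalPoly k) = 0) : ∃ g, (c.comp g).IsNormalized := by
  have h1 (k) : c.l 1 k = 0 := by
    have h := congrArg (coeff · 0) (hderiv k)
    simpa [coeff_derivative, ← c.coeff_normalPoly] using h
  have h2 (k) : c.l 2 k = 0 := by
    have two : (1 + 1 : K) ≠ 0 := by
      rw [one_add_one_eq_two]
      exact_mod_cast (CharP.cast_eq_zero_iff K 3 2).not.mpr (by decide)
    have h := congrArg (coeff · 1) (hderiv k)
    simpa [coeff_derivative, ← c.coeff_normalPoly, two] using h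
  have hpoly (k) : c.normalPoly k = C (c.l 0 k) + C (c.l 3 k) * X ^ 3 := by
    simp [normalPoly, Fin.sum_univ_four, h1, h2]
  let h : Matrix (Fin 2) (Fin 2) K := !![c.l 0 0, c.l 0 1; -c.l 3 0, -c.l 3 1]
  have hdet : h.det ≠ 0 := by
    intro hdet
    obtain ⟨v, hv, hhv⟩ := Matrix.exists_mulVec_eq_zero_iff.mpr hdet
    have e0 : c.l 0 0 * v 0 + c.l 0 1 * v 1 = 0 := by
      simpa [h, Matrix.mulVec, dotProduct, Fin.sum_univ_two] using congrFun hhv 0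
    have e3 : -(c.l 3 0 * v 0) + -(c.l 3 1 * v 1) = 0 := by
      simpa [h, Matrix.mulVec, dotProduct, Fin.sum_univ_two] using congrFun hhv 1
    have hv0 := LinearIndependent.pair_iff.mp hlin (v 0) (v 1) <| by
      simp only [hpoly, smul_eq_C_mul]
      have e0 := congrArg C e0
      have e3 := congrArg C e3
      simp only [map_add, map_mul, map_neg, C_0] at e0 e3
      linear_combination e0 - X ^ 3 * e3
    exact hv (funext (Fin.forall_fin_two.mpr hv0))
  have hl : c.l = (!![1, 0; 0, 0; 0, 0; 0, -1] : Matrix (Fin 4) (Fin 2) K) * h := by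
    ext j k
    fin_cases j <;> fin_cases k <;> simp [h, h1, h2, Matrix.mul_apply]
  refine ⟨(Matrix.GeneralLinearGroup.mkOfDetNeZero h hdet)⁻¹, ?_⟩
  have hinv : h * (Matrix.GeneralLinearGroup.mkOfDetNeZero h hdet)⁻¹.val = 1 :=
    Units.mul_inv (Matrix.GeneralLinearGroup.mkOfDetNeZero h hdet)
  rw [IsNormalized, comp, hl, Matrix.mul_assoc, hinv, Matrix.mul_one]

theorem IsInseparable.exists_isNormalized [Infinite K] [CharP K 3] {F : MvPolynomial (Fin 4) K}
    {ℓ : Submodule K (Fin 4 → K)} (hF : F.IsHomogeneous 4) (hℓ : IsLineOn F ℓ)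
    (h : IsInseparable F ℓ) : ∃ A, IsAdapted A ℓ ∧
      ∃ c : LineExpansion K, coords A F = c.quartic ∧ c.IsNormalized := by
  obtain ⟨A, hA, hconst, hsep⟩ := h
  obtain ⟨c, hc⟩ := hA.exists_coords_eq_quartic hF hℓ
  have hmap : inducedMap (coords A F) = -(algebraMap K[X] (RatFunc K) (c.normalPoly 1)) /
      algebraMap K[X] (RatFunc K) (c.normalPoly 0) := by
    rw [inducedMap, hc, ← c.normalDerivative_quartic, ← c.normalDerivative_quartic]
    rfl
  rw [hmap] at hconst hsep
  have hlin := linearIndependent_of_div_notMem_range hconst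
  have hderiv := derivative_eq_zero_of_wronskian_eq_zero three_ne_zero (c.natDegree_normalPoly_le 0)
    (c.natDegree_normalPoly_le 1) hlin
    (not_not.mp (mt isSeparable_adjoin_div_of_wronskian_ne_zero hsep))
  obtain ⟨g, hg⟩ := c.exists_isNormalized_comp hlin (Fin.forall_fin_two.mpr hderiv)
  exact ⟨A * pencilChange g, hA.mul_pencilChange g, c.comp g,
    by rw [coords_mul, hc, c.coords_pencilChange_quartic], hg⟩

end Normalization

section ContactPolynomial

open Polynomial

namespace LineExpansion

variable {K : Type*} [Field K] (c : LineExpansion K)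

/-- For a normalised expansion, the value of this polynomial at `s` is the derivative in the
direction of `x₁` of the residual cubic of the plane `x₀ = s³ x₁` at its contact point
`[0 : 0 : s : 1]` with the line: its zeros are the points where that cubic is singular. -/
noncomputable def contactPoly : K[X] :=
  ∑ j : Fin 3, X ^ (j : ℕ) * expand K 3 (dehomogenize (c.q j))

/-- The counterpart of `contactPoly` for the part of the quartic that is cubic in `x₀, x₁`. If
`contactPoly` vanishes, the residual cubic of the plane `x₀ = s³ x₁` has a cusp at its contact point
with the line as soon as the value at `s` is not zero. -/
noncomputable def cuspPoly : K[X] :=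
  ∑ j : Fin 2, X ^ (j : ℕ) * expand K 3 (dehomogenize (c.r j))

theorem eval_contactPoly (s : K) :
    c.contactPoly.eval s = ∑ j : Fin 3, s ^ (j : ℕ) * MvPolynomial.eval ![s ^ 3, 1] (c.q j) := by
  simp only [contactPoly, eval_finsetSum, eval_mul, eval_pow, eval_X, expand_eval,
    eval_dehomogenize]

theorem eval_cuspPoly (s : K) :
    c.cuspPoly.eval s = ∑ j : Fin 2, s ^ (j : ℕ) * MvPolynomial.eval ![s ^ 3, 1] (c.r j) := by
  simp only [cuspPoly, eval_finsetSum, eval_mul, eval_pow, eval_X, expand_eval,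
    eval_dehomogenize]

theorem eval_derivative_contactPoly [CharP K 3] (s : K) :
    c.contactPoly.derivative.eval s =
      MvPolynomial.eval ![s ^ 3, 1] (c.q 1) + 2 * s * MvPolynomial.eval ![s ^ 3, 1] (c.q 2) := by
  simp [contactPoly, Fin.sum_univ_three, derivative_expand, expand_eval, eval_dehomogenize,
    CharP.ofNat_eq_zero K 3, one_add_one_eq_two]

theorem natDegree_contactPoly_le : c.contactPoly.natDegree ≤ 8 := by
  refine natDegree_sum_le_of_forall_le _ _ fun j _ => natDegree_mul_le.trans ?_
  have hq := natDegree_dehomogenize_le (c.isHomogeneous_q j)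
  rw [natDegree_X_pow, natDegree_expand]
  omega

theorem coeff_contactPoly (j : Fin 3) :
    c.contactPoly.coeff (6 + j) = MvPolynomial.eval ![1, 0] (c.q j) := by
  rw [← coeff_dehomogenize (c.isHomogeneous_q j)]
  exact coeff_sum_X_pow_mul_expand le_rfl (fun j => dehomogenize (c.q j)) 2 j

variable {c}

theorem q_eq_zero_of_contactPoly_eq_zero (h : c.contactPoly = 0) (j : Fin 3) : c.q j = 0 :=
  eq_zero_of_dehomogenize_eq_zero (c.isHomogeneous_q j)
    (eq_zero_of_sum_X_pow_mul_expand_eq_zero le_rfl h j)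

theorem r_eq_zero_of_cuspPoly_eq_zero (h : c.cuspPoly = 0) (j : Fin 2) : c.r j = 0 :=
  eq_zero_of_dehomogenize_eq_zero (c.isHomogeneous_r j)
    (eq_zero_of_sum_X_pow_mul_expand_eq_zero (Nat.le_succ 2) h j)

end LineExpansion

end ContactPolynomial

section Lines

open MvPolynomial

variable {K : Type*} [Field K]

theorem eq_span_pair {V : Type*} [AddCommGroup V] [Module K V] {m : Submodule K V}
    (hm : Module.finrank K m = 2) {p w : V} (hp : p ∈ m) (hw : w ∈ m)
    (hli : LinearIndependent K ![p, w]) : m = Submodule.span K {p, w} := by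
  have : FiniteDimensional K m := Module.finite_of_finrank_eq_succ hm
  have hspan := finrank_span_eq_card hli
  rw [Matrix.range_cons_cons_empty, Fintype.card_fin] at hspan
  refine (Submodule.eq_of_le_of_finrank_eq ?_ (hspan.trans hm.symm)).symm
  exact Submodule.span_le.mpr (Set.pair_subset hp hw)

theorem cubic_eq_zero_of_eval_toPoly_eq_zero [Infinite K] {P : Cubic K}
    (h : ∀ z, P.toPoly.eval z = 0) : P = 0 :=
  (Cubic.toPoly_eq_zero_iff P).mp (Polynomial.funext fun z => by rw [h, Polynomial.eval_zero])

namespace LineExpansion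

variable {c : LineExpansion K}

theorem IsNormalized.eval_quartic (hc : c.IsNormalized) (v : Fin 4 → K) :
    eval v c.quartic = v 0 * v 3 ^ 3 - v 1 * v 2 ^ 3 +
      ∑ j : Fin 3, eval ![v 0, v 1] (c.q j) * v 2 ^ (j : ℕ) * v 3 ^ (2 - j : ℕ) +
      ∑ j : Fin 2, eval ![v 0, v 1] (c.r j) * v 2 ^ (j : ℕ) * v 3 ^ (1 - j : ℕ) +
      eval ![v 0, v 1] c.m := by
  rw [LineExpansion.eval_quartic, hc]
  simp [Fin.sum_univ_four, sub_eq_add_neg]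

/-- The restriction of the quartic to the line spanned by `(0, 0, a, b)` and `(x, y, d, e)`. -/
noncomputable def restrict (c : LineExpansion K) (x y a b d e : K) : Cubic K where
  a := x * b ^ 3 - y * a ^ 3
  b := eval ![x, y] (c.q 0) * b ^ 2 + eval ![x, y] (c.q 1) * (a * b) + eval ![x, y] (c.q 2) * a ^ 2
  c := eval ![x, y] (c.q 0) * (2 * b * e) + eval ![x, y] (c.q 1) * (a * e + b * d) +
    eval ![x, y] (c.q 2) * (2 * a * d) + (eval ![x, y] (c.r 0) * b + eval ![x, y] (c.r 1) * a)
  d := x * e ^ 3 - y * d ^ 3 + (eval ![x, y] (c.q 0) * e ^ 2 + eval ![x, y] (c.q 1) * (d * e) +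
    eval ![x, y] (c.q 2) * d ^ 2) + (eval ![x, y] (c.r 0) * e + eval ![x, y] (c.r 1) * d) +
    eval ![x, y] c.m

theorem IsNormalized.eval_restrict [CharP K 3] (hc : c.IsNormalized) (x y a b d e z : K) :
    (c.restrict x y a b d e).toPoly.eval z = eval ![x, y, z * a + d, z * b + e] c.quartic := by
  rw [hc.eval_quartic]
  simp only [restrict, Cubic.toPoly, Polynomial.eval_add, Polynomial.eval_mul, Polynomial.eval_C,
    Polynomial.eval_pow, Polynomial.eval_X, Fin.sum_univ_three, Fin.sum_univ_two, Matrix.cons_val,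
    Fin.coe_ofNat_eq_mod, Nat.reduceMod, Nat.reduceSub]
  linear_combination (z * a * d * (z * a + d) * y - z * b * e * (z * b + e) * x) *
    CharP.ofNat_eq_zero K 3

theorem IsNormalized.restrict_eq_zero [CharP K 3] [Infinite K] (hc : c.IsNormalized)
    {m : Submodule K (Fin 4 → K)} (hm : IsLineOn c.quartic m) {x y a b d e : K}
    (hp : ![0, 0, a, b] ∈ m) (hw : ![x, y, d, e] ∈ m) : c.restrict x y a b d e = 0 := by
  refine cubic_eq_zero_of_eval_toPoly_eq_zero fun z => ?_
  rw [hc.eval_restrict]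
  refine hm.eval_eq_zero _ ?_
  simpa using m.add_mem (m.smul_mem z hp) hw

/-- The line joining the point `[0 : 0 : s : 1]` to a point of its contact plane. -/
def affineLine (s n : K) : Submodule K (Fin 4 → K) :=
  Submodule.span K {![0, 0, s, 1], ![s ^ 3, 1, n, 0]}

/-- The line joining the point `[0 : 0 : 1 : 0]` to a point of its contact plane. -/
def infinityLine (n : K) : Submodule K (Fin 4 → K) :=
  Submodule.span K {![0, 0, 1, 0], ![1, 0, 0, n]}

theorem IsNormalized.exists_eq_affineLine [CharP K 3] [Infinite K] (hc : c.IsNormalized)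
    {m : Submodule K (Fin 4 → K)} (hm : IsLineOn c.quartic m) {s x y d e : K}
    (hp : ![0, 0, s, 1] ∈ m) (hw : ![x, y, d, e] ∈ m) (hxy : x ≠ 0 ∨ y ≠ 0) :
    ∃ n, c.restrict (s ^ 3) 1 s 1 n 0 = 0 ∧ m = affineLine s n := by
  obtain rfl : x = y * s ^ 3 := by
    have h : (c.restrict x y s 1 d e).a = 0 := congrArg Cubic.a (hc.restrict_eq_zero hm hp hw)
    simpa [restrict, sub_eq_zero] using h
  have hy : y ≠ 0 := by
    rintro rfl
    simp at hxy
  have hn : ![s ^ 3, 1, y⁻¹ * (d - e * s), 0] ∈ m := by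
    convert m.smul_mem y⁻¹ (m.sub_mem hw (m.smul_mem e hp)) using 1
    ext i
    fin_cases i <;> simp [hy]
  refine ⟨_, hc.restrict_eq_zero hm hp hn, eq_span_pair hm.finrank_eq hp hn ?_⟩
  refine LinearIndependent.pair_iff.mpr fun a b hab => ?_
  have hb : b = 0 := by simpa using congrFun hab 1
  exact ⟨by simpa [hb] using congrFun hab 3, hb⟩

theorem IsNormalized.exists_eq_infinityLine [CharP K 3] [Infinite K] (hc : c.IsNormalized)
    {m : Submodule K (Fin 4 → K)} (hm : IsLineOn c.quartic m) {x y d e : K}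
    (hp : ![0, 0, 1, 0] ∈ m) (hw : ![x, y, d, e] ∈ m) (hxy : x ≠ 0 ∨ y ≠ 0) :
    ∃ n, c.restrict 1 0 1 0 0 n = 0 ∧ m = infinityLine n := by
  obtain rfl : y = 0 := by
    have h : (c.restrict x y 1 0 d e).a = 0 := congrArg Cubic.a (hc.restrict_eq_zero hm hp hw)
    simpa [restrict] using h
  have hx : x ≠ 0 := by simpa using hxy
  have hn : ![1, 0, 0, x⁻¹ * e] ∈ m := by
    simpa [hx] using m.smul_mem x⁻¹ (m.sub_mem hw (m.smul_mem d hp))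
  refine ⟨_, hc.restrict_eq_zero hm hp hn, eq_span_pair hm.finrank_eq hp hn ?_⟩
  refine LinearIndependent.pair_iff.mpr fun a b hab => ?_
  have hb : b = 0 := by simpa using congrFun hab 0
  exact ⟨by simpa [hb] using congrFun hab 2, hb⟩

end LineExpansion

end Lines

section Counting

open Polynomial

variable {K : Type*} [Field K]

theorem two_mul_sum_card_roots_le [DecidableEq K] (f : K[X]) (N : K → Finset K)
    (h3 : ∀ s, (N s).card ≤ 3) (h1 : ∀ s, f.derivative.eval s ≠ 0 → (N s).card ≤ 1) :
    2 * ∑ s ∈ f.roots.toFinset, (N s).card ≤ 3 * f.natDegree := by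
  have hle : ∑ s ∈ f.roots.toFinset, f.roots.count s ≤ f.natDegree := by
    rw [Multiset.toFinset_sum_count_eq]
    exact f.card_roots'
  refine le_trans ?_ (Nat.mul_le_mul_left 3 hle)
  rw [Finset.mul_sum, Finset.mul_sum]
  refine Finset.sum_le_sum fun s hs => ?_
  rw [Multiset.mem_toFinset] at hs
  by_cases hd : f.derivative.eval s = 0
  · have hf : f ≠ 0 := ne_zero_of_mem_roots hs
    have hmult : 1 < f.roots.count s := by
      rw [count_roots]
      exact (one_lt_rootMultiplicity_iff_isRoot hf).mpr ⟨(mem_roots hf).mp hs, hd⟩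
    have := h3 s
    omega
  · have := Multiset.count_pos.mpr hs
    have := h1 s hd
    omega

namespace LineExpansion

open Classical in
/-- Contains the numbers `n` for which `affineLine s n` lies on the quartic. -/
noncomputable def affineSlopes (c : LineExpansion K) (s : K) : Finset K :=
  {n ∈ (Cubic.mk (-1) (MvPolynomial.eval ![s ^ 3, 1] (c.q 2))
      (MvPolynomial.eval ![s ^ 3, 1] (c.r 1)) (MvPolynomial.eval ![s ^ 3, 1] c.m)).roots.toFinset |
    c.contactPoly.derivative.eval s * n + c.cuspPoly.eval s = 0}

open Classical in
/-- Contains the numbers `n` for which `infinityLine n` lies on the quartic. It is empty unless the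
degree of `contactPoly` is smaller than 8, that is, unless its homogenisation of degree 8 vanishes
at infinity. -/
noncomputable def infinitySlopes (c : LineExpansion K) : Finset K :=
  {n ∈ (Cubic.mk 1 (MvPolynomial.eval ![1, 0] (c.q 0))
      (MvPolynomial.eval ![1, 0] (c.r 0)) (MvPolynomial.eval ![1, 0] c.m)).roots.toFinset |
    c.contactPoly.coeff 8 = 0 ∧
      c.contactPoly.coeff 7 * n + MvPolynomial.eval ![1, 0] (c.r 1) = 0}

variable {c : LineExpansion K}

theorem isRoot_contactPoly_of_restrict_eq_zero {s n : K}
    (h : c.restrict (s ^ 3) 1 s 1 n 0 = 0) : c.contactPoly.IsRoot s := by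
  have hb : (c.restrict (s ^ 3) 1 s 1 n 0).b = 0 := congrArg Cubic.b h
  rw [IsRoot, eval_contactPoly, ← hb]
  simp [restrict, Fin.sum_univ_three, mul_comm]

theorem mem_affineSlopes_of_restrict_eq_zero [CharP K 3] {s n : K}
    (h : c.restrict (s ^ 3) 1 s 1 n 0 = 0) : n ∈ c.affineSlopes s := by
  have hc : (c.restrict (s ^ 3) 1 s 1 n 0).c = 0 := congrArg Cubic.c h
  have hd : (c.restrict (s ^ 3) 1 s 1 n 0).d = 0 := congrArg Cubic.d h
  classical
  rw [affineSlopes, Finset.mem_filter, Multiset.mem_toFinset,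
    Cubic.mem_roots_iff (Cubic.ne_zero_of_a_ne_zero (neg_ne_zero.mpr one_ne_zero)),
    eval_derivative_contactPoly, eval_cuspPoly, Fin.sum_univ_two, Fin.val_zero, Fin.val_one]
  simp only [restrict] at hc hd
  exact ⟨by linear_combination hd, by linear_combination hc⟩

theorem mem_infinitySlopes_of_restrict_eq_zero {n : K} (h : c.restrict 1 0 1 0 0 n = 0) :
    n ∈ c.infinitySlopes := by
  have hb : (c.restrict 1 0 1 0 0 n).b = 0 := congrArg Cubic.b h
  have hc : (c.restrict 1 0 1 0 0 n).c = 0 := congrArg Cubic.c h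
  have hd : (c.restrict 1 0 1 0 0 n).d = 0 := congrArg Cubic.d h
  classical
  rw [infinitySlopes, Finset.mem_filter, Multiset.mem_toFinset,
    Cubic.mem_roots_iff (Cubic.ne_zero_of_a_ne_zero one_ne_zero),
    show c.contactPoly.coeff 8 = _ from c.coeff_contactPoly 2,
    show c.contactPoly.coeff 7 = _ from c.coeff_contactPoly 1]
  simp only [restrict] at hb hc hd
  exact ⟨by linear_combination hd, by linear_combination hb, by linear_combination hc⟩

variable (c)

theorem card_affineSlopes_le_three (s : K) : (c.affineSlopes s).card ≤ 3 := by
  classical exact (Finset.card_filter_le _ _).trans Cubic.card_roots_le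

theorem card_affineSlopes_le_one {s : K} (hs : c.contactPoly.derivative.eval s ≠ 0) :
    (c.affineSlopes s).card ≤ 1 := by
  classical
  refine Finset.card_le_one.mpr fun n hn n' hn' => mul_left_cancel₀ hs ?_
  exact add_right_cancel
    ((Finset.mem_filter.mp hn).2.trans (Finset.mem_filter.mp hn').2.symm)

theorem two_mul_card_infinitySlopes_le (hT : c.contactPoly ≠ 0) :
    2 * c.infinitySlopes.card + 3 * c.contactPoly.natDegree ≤ 24 := by
  classical
  have hdeg := c.natDegree_contactPoly_le
  have hlt (i : ℕ) (h : c.contactPoly.coeff i = 0) : c.contactPoly.natDegree ≠ i := by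
    rintro rfl
    exact hT (leadingCoeff_eq_zero.mp h)
  by_cases h8 : c.contactPoly.coeff 8 = 0
  · have hne8 := hlt 8 h8
    by_cases h7 : c.contactPoly.coeff 7 = 0
    · have hne7 := hlt 7 h7
      have h3 : c.infinitySlopes.card ≤ 3 :=
        (Finset.card_filter_le _ _).trans Cubic.card_roots_le
      omega
    · have h1 : c.infinitySlopes.card ≤ 1 :=
        Finset.card_le_one.mpr fun n hn n' hn' => mul_left_cancel₀ h7 <| add_right_cancel
          ((Finset.mem_filter.mp hn).2.2.trans (Finset.mem_filter.mp hn').2.2.symm)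
      omega
  · have h0 : c.infinitySlopes = ∅ := Finset.filter_false_of_mem fun _ _ h => h8 h.1
    rw [h0, Finset.card_empty]
    omega

open Classical in
/-- Contains the lines on the quartic, other than `x₀ = x₁ = 0`, that meet the line
`x₀ = x₁ = 0`. -/
noncomputable def incidentLines : Finset (Submodule K (Fin 4 → K)) :=
  c.contactPoly.roots.toFinset.biUnion (fun s => (c.affineSlopes s).image (affineLine s)) ∪
    c.infinitySlopes.image infinityLine

theorem card_incidentLines_le (hT : c.contactPoly ≠ 0) : c.incidentLines.card ≤ 12 := by
  classical
  have hunion : c.incidentLines.card ≤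
      ∑ s ∈ c.contactPoly.roots.toFinset, (c.affineSlopes s).card + c.infinitySlopes.card :=
    (Finset.card_union_le _ _).trans <| Nat.add_le_add
      (Finset.card_biUnion_le.trans (Finset.sum_le_sum fun _ _ => Finset.card_image_le))
      Finset.card_image_le
  have haffine := two_mul_sum_card_roots_le c.contactPoly c.affineSlopes
    c.card_affineSlopes_le_three fun _ => c.card_affineSlopes_le_one
  have hinfinity := c.two_mul_card_infinitySlopes_le hT
  omega

variable {c}

theorem IsNormalized.mem_incidentLines [CharP K 3] [Infinite K] (hc : c.IsNormalized)
    (hT : c.contactPoly ≠ 0) {m : Submodule K (Fin 4 → K)} (hm : IsLineOn c.quartic m)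
    {a b x y d e : K} (hab : a ≠ 0 ∨ b ≠ 0) (hp : ![0, 0, a, b] ∈ m) (hw : ![x, y, d, e] ∈ m)
    (hxy : x ≠ 0 ∨ y ≠ 0) : m ∈ c.incidentLines := by
  classical
  rw [incidentLines, Finset.mem_union, Finset.mem_biUnion]
  by_cases hb : b = 0
  · have ha : a ≠ 0 := hab.resolve_right (not_not.mpr hb)
    have hp' : ![0, 0, 1, 0] ∈ m := by simpa [ha, hb] using m.smul_mem a⁻¹ hp
    obtain ⟨n, hn, rfl⟩ := hc.exists_eq_infinityLine hm hp' hw hxy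
    exact .inr (Finset.mem_image_of_mem _ (mem_infinitySlopes_of_restrict_eq_zero hn))
  · have hp' : ![0, 0, b⁻¹ * a, 1] ∈ m := by simpa [hb] using m.smul_mem b⁻¹ hp
    obtain ⟨n, hn, rfl⟩ := hc.exists_eq_affineLine hm hp' hw hxy
    refine .inl ⟨_, ?_, Finset.mem_image_of_mem _ (mem_affineSlopes_of_restrict_eq_zero hn)⟩
    rw [Multiset.mem_toFinset, mem_roots hT]
    exact isRoot_contactPoly_of_restrict_eq_zero hn

end LineExpansion

theorem valency_le_twelve [CharP K 3] [Infinite K] {F : MvPolynomial (Fin 4) K}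
    {ℓ : Submodule K (Fin 4 → K)} (hℓ : IsLineOn F ℓ) {A : GL (Fin 4) K} (hA : IsAdapted A ℓ)
    {c : LineExpansion K} (hcoords : coords A F = c.quartic) (hc : c.IsNormalized)
    (hT : c.contactPoly ≠ 0) : valency F ℓ ≤ 12 := by
  have hcard : (c.incidentLines : Set (Submodule K (Fin 4 → K))).encard ≤ 12 := by
    rw [Set.encard_coe_eq_coe_finsetCard]
    exact_mod_cast c.card_incidentLines_le hT
  have hinj : Function.Injective (Submodule.comap A.val.mulVecLin) :=
    Submodule.comap_injective_of_surjective (exists_mulVec_eq A)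
  refine le_trans (Set.encard_le_encard_of_injOn ?_ hinj.injOn) hcard
  rintro m ⟨hm, hne, P, ⟨hPm, hPℓ⟩, -⟩
  obtain ⟨u, v, huv⟩ := hA.exists_mulVec_eq_rep hPℓ
  obtain ⟨w, hwm, hwℓ⟩ : ∃ w, A.val.mulVec w ∈ m ∧ A.val.mulVec w ∉ ℓ := by
    by_contra! h
    refine hne (Submodule.eq_of_le_of_finrank_eq (fun x hx => ?_)
      (hm.finrank_eq.trans hℓ.finrank_eq.symm))
    obtain ⟨w, rfl⟩ := exists_mulVec_eq A x
    exact h w hx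
  refine hc.mem_incidentLines hT (a := u) (b := v) (x := w 0) (y := w 1) (d := w 2) (e := w 3)
    (hcoords ▸ hm.comap A) ?_ ?_ ?_ ?_
  · by_contra! h
    refine P.rep_nonzero ?_
    rw [← huv, h.1, h.2, show ![0, 0, 0, 0] = (0 : Fin 4 → K) by simp, Matrix.mulVec_zero]
  · rw [Submodule.mem_comap, Matrix.mulVecLin_apply, huv]
    exact mem_points_iff.mp hPm
  · rwa [show ![w 0, w 1, w 2, w 3] = w from funext (by simp [Fin.forall_fin_succ])]
  · rwa [hA.mulVec_mem_iff, not_and_or] at hwℓ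

end Counting

section ResidualCubic

open MvPolynomial

variable {K : Type*} [Field K]

theorem aeval_C_mul_X_X_of_isHomogeneous {f : MvPolynomial (Fin 2) K} {n : ℕ}
    (hf : f.IsHomogeneous n) (t : K) :
    aeval (![C t * X 0, X 0] : Fin 2 → MvPolynomial (Fin 3) K) f =
      X 0 ^ n * C (eval ![t, 1] f) := by
  have h : aeval (fun i => algebraMap K (MvPolynomial (Fin 3) K) (![t, 1] i)) f =
      C (eval ![t, 1] f) := aeval_algebraMap_apply _ _ f
  rw [← h, ← aeval_mul_left_of_isHomogeneous hf]
  exact congrArg (aeval · f) (funext (Fin.forall_fin_two.mpr (by simp [mul_comm])))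

namespace LineExpansion

theorem residualCubic_quartic (c : LineExpansion K) (t : K) : residualCubic c.quartic t =
    ∑ j : Fin 4, C (t * c.l j 0 + c.l j 1) * X 1 ^ (j : ℕ) * X 2 ^ (3 - j : ℕ) +
      X 0 * ∑ j : Fin 3, C (eval ![t, 1] (c.q j)) * X 1 ^ (j : ℕ) * X 2 ^ (2 - j : ℕ) +
      X 0 ^ 2 * ∑ j : Fin 2, C (eval ![t, 1] (c.r j)) * X 1 ^ (j : ℕ) * X 2 ^ (1 - j : ℕ) +
      X 0 ^ 3 * C (eval ![t, 1] c.m) := by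
  refine Eq.trans (congrArg (divMonomial · _) ?_) (X_mul_divMonomial 0 _)
  rw [aeval_quartic]
  simp only [Matrix.cons_val, algebraMap_eq, aeval_C_mul_X_X_of_isHomogeneous (c.isHomogeneous_q _),
    aeval_C_mul_X_X_of_isHomogeneous (c.isHomogeneous_r _),
    aeval_C_mul_X_X_of_isHomogeneous c.isHomogeneous_m, mul_add, Finset.mul_sum, C_add, C_mul]
  refine congrArg₂ _ (congrArg₂ _ (congrArg₂ _ ?_ ?_) ?_) ?_
  iterate 3 exact Finset.sum_congr rfl fun _ _ => by ring
  ring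

theorem isCusp_residualCubic_quartic {c : LineExpansion K} {t s k : K}
    (h : IsCusp (residualCubic c.quartic t) ![0, k * s, k]) :
    t * (c.normalPoly 0).eval s + (c.normalPoly 1).eval s = 0 ∧
      t * (c.normalPoly 0).derivative.eval s + (c.normalPoly 1).derivative.eval s = 0 ∧
      ∑ j : Fin 3, s ^ (j : ℕ) * eval ![t, 1] (c.q j) = 0 := by
  obtain ⟨hne, h, hpderiv, -⟩ := h
  have hk : k ≠ 0 := by
    rintro rfl
    exact hne (by simp)
  have hvalue : eval ![0, k * s, k] (residualCubic c.quartic t) =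
      k ^ 3 * (t * (c.normalPoly 0).eval s + (c.normalPoly 1).eval s) := by
    rw [residualCubic_quartic]
    simp [normalPoly, Fin.sum_univ_four]
    ring
  have hpderiv_zero : eval ![0, k * s, k] (pderiv 0 (residualCubic c.quartic t)) =
      k ^ 2 * ∑ j : Fin 3, s ^ (j : ℕ) * eval ![t, 1] (c.q j) := by
    rw [residualCubic_quartic]
    simp [pderiv_X, Fin.sum_univ_three, Fin.sum_univ_four, Fin.sum_univ_two]
    ring
  have hpderiv_one : eval ![0, k * s, k] (pderiv 1 (residualCubic c.quartic t)) =
      k ^ 2 * (t * (c.normalPoly 0).derivative.eval s + (c.normalPoly 1).derivative.eval s) := by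
    rw [residualCubic_quartic]
    simp [normalPoly, pderiv_X, Fin.sum_univ_four]
    ring
  exact ⟨(mul_eq_zero.mp (hvalue ▸ h)).resolve_left (pow_ne_zero 3 hk),
    (mul_eq_zero.mp (hpderiv_one ▸ hpderiv 1)).resolve_left (pow_ne_zero 2 hk),
    (mul_eq_zero.mp (hpderiv_zero ▸ hpderiv 0)).resolve_left (pow_ne_zero 2 hk)⟩

end LineExpansion

end ResidualCubic

section CuspidalCubic

open MvPolynomial

variable {K : Type*} [Field K]

theorem irreducible_X_sq_mul_X_add_X_pow_three :
    Irreducible (X 0 ^ 2 * X 2 + X 1 ^ 3 : MvPolynomial (Fin 3) K) := by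
  refine irreducible_mul_X_add _ _ 2 (pow_ne_zero 2 (X_ne_zero 0)) ?_ ?_ ?_
  · exact fun h => by simpa [vars_X] using vars_pow _ _ h
  · exact fun h => by simpa [vars_X] using vars_pow _ _ h
  · refine IsRelPrime.pow ?_
    rw [(X_prime (i := 0)).irreducible.isRelPrime_iff_not_dvd, X_dvd_X]
    simp

/-- The plane cubic `(s x₂ - x₁)³ + x₀² (b₀ x₂ + b₁ x₁) + m x₀³`. In characteristic 3 it has a cusp
at `[0 : s : 1]`, unless `b₀ + b₁ s = 0`. -/
noncomputable def cuspidalCubic (s b₀ b₁ m : K) : MvPolynomial (Fin 3) K :=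
  (C s * X 2 - X 1) ^ 3 + X 0 ^ 2 * (C b₀ * X 2 + C b₁ * X 1) + X 0 ^ 3 * C m

variable {s b₀ b₁ m : K}

theorem irreducible_cuspidalCubic (hk : b₀ + b₁ * s ≠ 0) :
    Irreducible (cuspidalCubic s b₀ b₁ m) := by
  have hCk : (C (b₀ + b₁ * s)⁻¹ : MvPolynomial (Fin 3) K) * (C b₀ + C b₁ * C s) = 1 := by
    rw [← C_mul, ← C_add, ← C_mul, inv_mul_cancel₀ hk, C_1]
  let φ : MvPolynomial (Fin 3) K →ₐ[K] MvPolynomial (Fin 3) K :=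
    aeval ![X 0, C s * X 2 - X 1, C b₀ * X 2 + C b₁ * X 1 + C m * X 0]
  let ψ : MvPolynomial (Fin 3) K →ₐ[K] MvPolynomial (Fin 3) K :=
    aeval ![X 0, C s * (C (b₀ + b₁ * s)⁻¹ * (X 2 + C b₁ * X 1 - C m * X 0)) - X 1,
      C (b₀ + b₁ * s)⁻¹ * (X 2 + C b₁ * X 1 - C m * X 0)]
  have hφψ : φ.comp ψ = AlgHom.id K _ := by
    ext1 i
    fin_cases i
    · simp [φ, ψ]
    · suffices C s * (C (b₀ + b₁ * s)⁻¹ * (C b₀ * X 2 + C b₁ * X 1 + C m * X 0 +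
          C b₁ * (C s * X 2 - X 1) - C m * X 0)) - (C s * X 2 - X 1) =
          (X 1 : MvPolynomial (Fin 3) K) by simpa [φ, ψ] using this
      linear_combination (C s * X 2) * hCk
    · suffices C (b₀ + b₁ * s)⁻¹ * (C b₀ * X 2 + C b₁ * X 1 + C m * X 0 +
          C b₁ * (C s * X 2 - X 1) - C m * X 0) = (X 2 : MvPolynomial (Fin 3) K) by
        simpa [φ, ψ] using this
      linear_combination X 2 * hCk
  have hψφ : ψ.comp φ = AlgHom.id K _ := by
    ext1 i
    fin_cases i
    · simp [φ, ψ]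
    · simp [φ, ψ]
    · suffices C b₀ * (C (b₀ + b₁ * s)⁻¹ * (X 2 + C b₁ * X 1 - C m * X 0)) +
          C b₁ * (C s * (C (b₀ + b₁ * s)⁻¹ * (X 2 + C b₁ * X 1 - C m * X 0)) - X 1) + C m * X 0 =
          (X 2 : MvPolynomial (Fin 3) K) by simpa [φ, ψ] using this
      linear_combination (X 2 + C b₁ * X 1 - C m * X 0) * hCk
  have h := (MulEquiv.irreducible_iff (AlgEquiv.ofAlgHom φ ψ hφψ hψφ)).mpr
    irreducible_X_sq_mul_X_add_X_pow_three
  convert h using 1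
  simp [cuspidalCubic, φ]
  ring

variable [CharP K 3]

theorem pderiv_cuspidalCubic (i : Fin 3) : pderiv i (cuspidalCubic s b₀ b₁ m) =
    ![(C b₀ * X 2 + C b₁ * X 1) * (2 * X 0), X 0 ^ 2 * C b₁, X 0 ^ 2 * C b₀] i := by
  have three : (3 : MvPolynomial (Fin 3) K) = 0 := CharP.ofNat_eq_zero _ 3
  fin_cases i <;> simp [cuspidalCubic, pderiv_X, three]

theorem isCusp_cuspidalCubic (hk : b₀ + b₁ * s ≠ 0) :
    IsCusp (cuspidalCubic s b₀ b₁ m) ![0, s, 1] := by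
  have two : (2 : K) ≠ 0 := by
    exact_mod_cast (CharP.cast_eq_zero_iff K 3 2).not.mpr (by decide)
  have hessian : (Matrix.of fun i j => eval ![0, s, 1]
      (pderiv i (pderiv j (cuspidalCubic s b₀ b₁ m)))) =
      Matrix.diagonal ![2 * (b₀ + b₁ * s), 0, 0] := by
    ext i j
    rw [Matrix.of_apply, pderiv_cuspidalCubic]
    fin_cases i <;> fin_cases j <;> simp [pderiv_X, mul_comm]
  refine ⟨fun h => one_ne_zero (congrFun h 2), by simp [cuspidalCubic], fun i => ?_, ?_⟩
  · rw [pderiv_cuspidalCubic]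
    fin_cases i <;> simp
  · classical
    rw [hessian, Matrix.rank_diagonal, Fintype.card_eq_one_iff]
    refine ⟨⟨0, by simpa using ⟨two, hk⟩⟩, ?_⟩
    rintro ⟨i, hi⟩
    fin_cases i <;> simp at hi ⊢

theorem eq_zero_of_isCusp_cuspidalCubic (hk : b₀ + b₁ * s ≠ 0) {p : Fin 3 → K}
    (hp : IsCusp (cuspidalCubic s b₀ b₁ m) p) : p 0 = 0 := by
  have h1 : p 0 ^ 2 * b₁ = 0 := by simpa [pderiv_cuspidalCubic] using hp.2.2.1 1
  have h2 : p 0 ^ 2 * b₀ = 0 := by simpa [pderiv_cuspidalCubic] using hp.2.2.1 2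
  refine pow_eq_zero_iff two_ne_zero |>.mp ((mul_eq_zero.mp ?_).resolve_right hk)
  linear_combination h2 + s * h1

theorem LineExpansion.IsNormalized.residualCubic_quartic {c : LineExpansion K}
    (hc : c.IsNormalized) (hq : ∀ j, c.q j = 0) (s : K) :
    residualCubic c.quartic (s ^ 3) = cuspidalCubic s (eval ![s ^ 3, 1] (c.r 0))
      (eval ![s ^ 3, 1] (c.r 1)) (eval ![s ^ 3, 1] c.m) := by
  rw [LineExpansion.residualCubic_quartic, hc, cuspidalCubic, sub_pow_char]
  simp [Fin.sum_univ_four, Fin.sum_univ_two, hq]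
  ring

end CuspidalCubic

section ZariskiClosure

open MvPolynomial

variable {K : Type*} [Field K]

theorem eval_eq_zero_of_infinite {G : MvPolynomial (Fin 4) K} {n : ℕ} (hG : G.IsHomogeneous n)
    (h : {s | eval ![0, 0, s, 1] G = 0}.Infinite) (u v : K) : eval ![0, 0, u, v] G = 0 := by
  let x : Fin 4 → MvPolynomial (Fin 2) K := ![0, 0, X 0, X 1]
  have hx (i : Fin 4) : (x i).IsHomogeneous 1 := by
    fin_cases i
    exacts [isHomogeneous_zero _ _ _, isHomogeneous_zero _ _ _, isHomogeneous_X K 0,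
      isHomogeneous_X K 1]
  have heval (u v : K) : eval ![u, v] (aeval x G) = eval ![0, 0, u, v] G := by
    rw [← coe_aeval_eq_eval, ← coe_aeval_eq_eval]
    change aeval ![u, v] (aeval x G) = _
    rw [comp_aeval_apply]
    refine congrArg (aeval · G) (funext fun i => ?_)
    fin_cases i <;> simp [x]
  have hhom : (aeval x G).IsHomogeneous (1 * n) := hG.aeval x hx
  rw [← heval, eq_zero_of_dehomogenize_eq_zero hhom, map_zero]
  refine Polynomial.eq_zero_of_infinite_isRoot _ (h.mono fun s hs => ?_)
  rw [Set.mem_ofPred_eq, Polynomial.IsRoot, eval_dehomogenize, heval]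
  exact hs

theorem subset_zariskiClosure (T : Set (ℙ K (Fin 4 → K))) : T ⊆ zariskiClosure T :=
  fun P hP _ _ _ h => h P hP

theorem eval_rep_mk_eq_zero_iff {H : MvPolynomial (Fin 4) K} {n : ℕ} (hH : H.IsHomogeneous n)
    {v : Fin 4 → K} (hv : v ≠ 0) :
    eval (Projectivization.mk K v hv).rep H = 0 ↔ eval v H = 0 := by
  obtain ⟨a, ha⟩ := Projectivization.exists_smul_eq_mk_rep K v hv
  rw [← ha, Units.smul_def, eval_smul_of_isHomogeneous hH, mul_eq_zero,
    or_iff_right (pow_ne_zero n a.ne_zero)]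

theorem eval_mulVec_coords_inv (A : GL (Fin 4) K) (H : MvPolynomial (Fin 4) K)
    (v : Fin 4 → K) : eval (A.val.mulVec v) (coords A⁻¹ H) = eval v H := by
  rw [eval_coords, Matrix.mulVec_mulVec, Units.inv_mul, Matrix.one_mulVec]

/-- The point `[0 : 0 : s : 1]` in the coordinates given by `A`; if `ℓ` is `x₀ = x₁ = 0` in these
coordinates, these are all points of `ℓ` but one. -/
def linePoint (A : GL (Fin 4) K) (s : K) : ℙ K (Fin 4 → K) :=
  .mk K (A.val.mulVec ![0, 0, s, 1]) (mulVec_ne_zero A fun h => one_ne_zero (congrFun h 3))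

variable {A : GL (Fin 4) K} {ℓ : Submodule K (Fin 4 → K)} {T : Set (ℙ K (Fin 4 → K))}
  {P : ℙ K (Fin 4 → K)}

theorem IsAdapted.linePoint_mem_points (hA : IsAdapted A ℓ) (s : K) : linePoint A s ∈ points ℓ := by
  change Projectivization.submodule _ ≤ ℓ
  rw [linePoint, Projectivization.submodule_mk, Submodule.span_singleton_le_iff_mem,
    hA.mulVec_mem_iff]
  simp

theorem linePoint_div_eq {u v : K} (hv : v ≠ 0) (h : A.val.mulVec ![0, 0, u, v] = P.rep) :
    linePoint A (u / v) = P := by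
  rw [← P.mk_rep, linePoint, Projectivization.mk_eq_mk_iff']
  refine ⟨v⁻¹, ?_⟩
  rw [← h, ← Matrix.mulVec_smul]
  congr 1
  ext i
  fin_cases i <;> simp [hv, div_eq_inv_mul]

theorem IsAdapted.zariskiClosure_subset_points (hA : IsAdapted A ℓ) (hT : T ⊆ points ℓ) :
    zariskiClosure T ⊆ points ℓ := by
  intro P hP
  obtain ⟨w, hw⟩ := exists_mulVec_eq A P.rep
  have hcoord (k : Fin 4) (hk : ∀ u v : K, ![0, 0, u, v] k = 0) : w k = 0 := by
    have h := hP 1 (coords A⁻¹ (X k)) (isHomogeneous_coords _ (isHomogeneous_X K k)) fun Q hQ => by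
      obtain ⟨u, v, huv⟩ := hA.exists_mulVec_eq_rep (hT hQ)
      rw [← huv, eval_mulVec_coords_inv, eval_X, hk]
    rwa [← hw, eval_mulVec_coords_inv, eval_X] at h
  rw [mem_points_iff, ← hw, hA.mulVec_mem_iff]
  exact ⟨hcoord 0 fun _ _ => rfl, hcoord 1 fun _ _ => rfl⟩

theorem IsAdapted.points_subset_zariskiClosure (hA : IsAdapted A ℓ)
    (hT : {s | linePoint A s ∈ T}.Infinite) : points ℓ ⊆ zariskiClosure T := by
  intro P hP n H hH hvanish
  obtain ⟨u, v, huv⟩ := hA.exists_mulVec_eq_rep hP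
  rw [← huv, ← eval_coords]
  refine eval_eq_zero_of_infinite (isHomogeneous_coords A hH) (hT.mono fun s hs => ?_) u v
  rw [Set.mem_ofPred_eq, eval_coords]
  exact (eval_rep_mk_eq_zero_iff hH _).mp (hvanish _ hs)

theorem IsAdapted.infinite_linePoint_mem [Infinite K] (hA : IsAdapted A ℓ)
    (hT : zariskiClosure T = points ℓ) : {s | linePoint A s ∈ T}.Infinite := by
  intro hfin
  let H : MvPolynomial (Fin 4) K := X 3 * ∏ s ∈ hfin.toFinset, (X 2 - C s * X 3)
  have hH : H.IsHomogeneous (1 + ∑ s ∈ hfin.toFinset, 1) :=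
    (isHomogeneous_X K 3).mul (IsHomogeneous.prod _ _ _ fun s _ =>
      (isHomogeneous_X K 2).sub ((isHomogeneous_X K 3).C_mul s))
  have heval (w : Fin 4 → K) : eval w H = w 3 * ∏ s ∈ hfin.toFinset, (w 2 - s * w 3) := by
    simp [H, map_prod]
  have hvanish (P) (hP : P ∈ T) : eval P.rep (coords A⁻¹ H) = 0 := by
    obtain ⟨u, v, huv⟩ := hA.exists_mulVec_eq_rep (hT ▸ subset_zariskiClosure T hP)
    rw [← huv, eval_mulVec_coords_inv, heval]
    by_cases hv : v = 0
    · exact mul_eq_zero_of_left hv _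
    · refine mul_eq_zero_of_right _ (Finset.prod_eq_zero (i := u / v) ?_ ?_)
      · rw [Set.Finite.mem_toFinset, Set.mem_ofPred_eq, linePoint_div_eq hv huv]
        exact hP
      · exact sub_eq_zero.mpr (div_mul_cancel₀ u hv).symm
  obtain ⟨s, hs⟩ := hfin.infinite_compl.nonempty
  have hmem : linePoint A s ∈ zariskiClosure T := hT ▸ hA.linePoint_mem_points s
  have hzero := (eval_rep_mk_eq_zero_iff (isHomogeneous_coords A⁻¹ hH) _).mp
    (hmem _ _ (isHomogeneous_coords A⁻¹ hH) hvanish)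
  rw [eval_mulVec_coords_inv, heval] at hzero
  obtain ⟨s', hs', h⟩ := Finset.prod_eq_zero_iff.mp
    ((mul_eq_zero.mp hzero).resolve_left one_ne_zero)
  obtain rfl : s = s' := sub_eq_zero.mp (by simpa using h)
  exact hs (hfin.mem_toFinset.mp hs')

theorem linePoint_mem_cusps_iff {F : MvPolynomial (Fin 4) K} {S : Set K} {s : K} :
    linePoint A s ∈ cusps A F S ↔
      ∃ t ∉ S, ∃ k, IsCusp (residualCubic (coords A F) t) ![0, k * s, k] := by
  simp only [cusps, linePoint, Set.mem_ofPred_eq, Projectivization.submodule_mk]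
  refine exists_congr fun t => and_congr_right fun _ => ⟨?_, ?_⟩
  · rintro ⟨p, hp, h⟩
    obtain ⟨k, hk⟩ := Submodule.span_singleton_eq_span_singleton.mp h
    rw [Units.smul_def, ← Matrix.mulVec_smul] at hk
    have hv := mulVec_injective A hk
    refine ⟨k, ?_⟩
    convert hp using 1
    ext i
    have h := congrFun hv i.succ
    fin_cases i <;> simpa using h
  · rintro ⟨k, hk⟩
    refine ⟨_, hk, ?_⟩
    have hk0 : k ≠ 0 := fun h => hk.1 (by simp [h])
    rw [← Submodule.span_singleton_smul_eq (IsUnit.mk0 k hk0), ← Matrix.mulVec_smul]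
    simp

theorem IsAdapted.cusps_subset_points (hA : IsAdapted A ℓ) {F : MvPolynomial (Fin 4) K}
    {S : Set K} (h : ∀ t ∉ S, ∀ p, IsCusp (residualCubic (coords A F) t) p → p 0 = 0) :
    cusps A F S ⊆ points ℓ := by
  rintro P ⟨t, ht, p, hp, hP⟩
  change P.submodule ≤ ℓ
  rw [hP, Submodule.span_singleton_le_iff_mem, hA.mulVec_mem_iff]
  simp [h t ht p hp]

end ZariskiClosure

section NormalizedExpansion

open MvPolynomial

variable {K : Type*} [Field K]

theorem LineExpansion.IsNormalized.quartic_eq_familyC {c : LineExpansion K} (hc : c.IsNormalized)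
    (hq : ∀ j, c.q j = 0) : c.quartic = familyC (c.r 1) (c.r 0) c.m := by
  rw [quartic, hc, familyC]
  simp [hq, Fin.sum_univ_four, Fin.sum_univ_two]
  ring

theorem isHomogeneous_familyC {q₃ q₃' q₄ : MvPolynomial (Fin 2) K} (hq₃ : q₃.IsHomogeneous 3)
    (hq₃' : q₃'.IsHomogeneous 3) (hq₄ : q₄.IsHomogeneous 4) :
    (familyC q₃ q₃' q₄).IsHomogeneous 4 :=
  (((((isHomogeneous_X K 0).mul (isHomogeneous_X_pow 3 3)).sub
    ((isHomogeneous_X K 1).mul (isHomogeneous_X_pow 2 3))).add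
    ((isHomogeneous_X K 2).mul hq₃.rename_isHomogeneous)).add
    ((isHomogeneous_X K 3).mul hq₃'.rename_isHomogeneous)).add hq₄.rename_isHomogeneous

variable [CharP K 3] [PerfectField K]

theorem exists_pow_three_eq (a : K) : ∃ b, b ^ 3 = a :=
  surjective_frobenius K 3 a

theorem exists_isSingularVector_familyC_zero {m : MvPolynomial (Fin 2) K} (hm : m.IsHomogeneous 4)
    (s : K) : ∃ y z, IsSingularVector (familyC 0 0 m) ![s, 1, y, z] := by
  obtain ⟨y, hy⟩ := exists_pow_three_eq (eval ![s, 1] (pderiv 1 m))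
  obtain ⟨z, hz⟩ := exists_pow_three_eq (-eval ![s, 1] (pderiv 0 m))
  have three : (3 : K) = 0 := CharP.ofNat_eq_zero K 3
  have four : ((4 : ℕ) : K) ≠ 0 := (CharP.cast_eq_zero_iff K 3 4).not.mpr (by decide)
  have hpderiv_zero : pderiv 0 (rename (![0, 1] : Fin 2 → Fin 4) m) = rename ![0, 1] (pderiv 0 m) :=
    pderiv_rename_fin_two 0 m
  have hpderiv_one : pderiv 1 (rename (![0, 1] : Fin 2 → Fin 4) m) = rename ![0, 1] (pderiv 1 m) :=
    pderiv_rename_fin_two 1 m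
  refine ⟨y, z, isSingularVector_of_pderiv (isHomogeneous_familyC (isHomogeneous_zero _ _ _)
    (isHomogeneous_zero _ _ _) hm) four fun i => ?_⟩
  fin_cases i
  · simp [familyC, pderiv_X, hpderiv_zero, eval_rename_fin_two, hz]
  · simp [familyC, pderiv_X, hpderiv_one, eval_rename_fin_two, hy]
  · simp [familyC, pderiv_X, pderiv_rename_fin_two_eq_zero, three]
  · simp [familyC, pderiv_X, pderiv_rename_fin_two_eq_zero, three]

variable {F : MvPolynomial (Fin 4) K} {ℓ : Submodule K (Fin 4 → K)} {A : GL (Fin 4) K}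
  {c : LineExpansion K}

theorem LineExpansion.IsNormalized.cuspPoly_ne_zero [Infinite K] (hF : F.IsHomogeneous 4)
    (hsing : (singularPoints F).Finite) (hcoords : coords A F = c.quartic) (hc : c.IsNormalized)
    (hq : ∀ j, c.q j = 0) : c.cuspPoly ≠ 0 := by
  intro h
  have hr := r_eq_zero_of_cuspPoly_eq_zero h
  rw [hc.quartic_eq_familyC hq, hr, hr] at hcoords
  choose y z hyz using exists_isSingularVector_familyC_zero c.isHomogeneous_m
  refine infinite_singularPoints hF A (fun s h => one_ne_zero (congrFun h 1)) (fun s s' a h => ?_)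
    (hcoords ▸ hyz) hsing
  have ha : a = 1 := by simpa using congrFun h 1
  simpa [ha] using congrFun h 0

theorem LineExpansion.IsNormalized.exists_residualCubic_eq (hc : c.IsNormalized)
    (hq : ∀ j, c.q j = 0) {t : K} (ht : t ∉ (· ^ 3) '' {s | c.cuspPoly.IsRoot s}) :
    ∃ s b₀ b₁ m, s ^ 3 = t ∧ b₀ + b₁ * s ≠ 0 ∧
      residualCubic c.quartic t = cuspidalCubic s b₀ b₁ m := by
  obtain ⟨s, rfl⟩ := exists_pow_three_eq t
  refine ⟨s, _, _, _, rfl, fun h => ht ⟨s, ?_, rfl⟩, hc.residualCubic_quartic hq s⟩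
  rw [Set.mem_ofPred_eq, Polynomial.IsRoot, eval_cuspPoly, Fin.sum_univ_two]
  simpa [mul_comm] using h

theorem LineExpansion.IsNormalized.isCuspidal [Infinite K] (hA : IsAdapted A ℓ)
    (hcoords : coords A F = c.quartic) (hc : c.IsNormalized) (hq : ∀ j, c.q j = 0)
    (hcusp : c.cuspPoly ≠ 0) : IsCuspidal F ℓ := by
  set S₀ := (· ^ 3) '' {s | c.cuspPoly.IsRoot s}
  have hfin : S₀.Finite := (Polynomial.finite_setOfPred_isRoot hcusp).image _
  refine ⟨⟨A, hA, hfin.subset fun t ht => ?_⟩, A, hA, S₀, hfin, fun S hS hsub => ?_⟩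
  · by_contra hS₀
    obtain ⟨s, b₀, b₁, m, -, hk, h⟩ := hc.exists_residualCubic_eq hq hS₀
    refine ht ?_
    rw [hcoords, h]
    exact ⟨irreducible_cuspidalCubic hk, _, isCusp_cuspidalCubic hk⟩
  · refine (hA.zariskiClosure_subset_points (hA.cusps_subset_points fun t ht p hp => ?_)).antisymm
      (hA.points_subset_zariskiClosure ?_)
    · obtain ⟨s, b₀, b₁, m, -, hk, h⟩ := hc.exists_residualCubic_eq hq fun h => ht (hsub h)
      rw [hcoords, h] at hp
      exact eq_zero_of_isCusp_cuspidalCubic hk hp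
    · have hcubes : ((· ^ 3) ⁻¹' S).Finite :=
        hS.preimage (frobenius_inj K 3).injOn
      refine hcubes.infinite_compl.mono fun s hs => linePoint_mem_cusps_iff.mpr ⟨s ^ 3, hs, 1, ?_⟩
      obtain ⟨s', b₀, b₁, m, hs', hk, h⟩ := hc.exists_residualCubic_eq hq fun h => hs (hsub h)
      obtain rfl : s' = s := frobenius_inj K 3 hs'
      rw [hcoords, h, one_mul]
      exact isCusp_cuspidalCubic hk

theorem IsInseparable.isCuspidal [Infinite K] (hF : F.IsHomogeneous 4)
    (hsing : (singularPoints F).Finite) (hℓ : IsLineOn F ℓ) (h : IsInseparable F ℓ)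
    (hvalency : 12 < valency F ℓ) : IsCuspidal F ℓ := by
  obtain ⟨A, hA, c, hcoords, hc⟩ := h.exists_isNormalized hF hℓ
  have hcontact : c.contactPoly = 0 := by
    by_contra hT
    exact hvalency.not_ge (valency_le_twelve hℓ hA hcoords hc hT)
  have hq := LineExpansion.q_eq_zero_of_contactPoly_eq_zero hcontact
  exact hc.isCuspidal hA hcoords hq (hc.cuspPoly_ne_zero hF hsing hcoords hq)

end NormalizedExpansion

section CuspidalCurve

open MvPolynomial

variable {K : Type*} [Field K]

namespace LineExpansion

variable {c : LineExpansion K}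

theorem normalPoly_comp (c : LineExpansion K) (g : GL (Fin 2) K) (k : Fin 2) :
    (c.comp g).normalPoly k = ∑ i, Polynomial.C (g i k) * c.normalPoly i := by
  simp only [normalPoly, comp, Matrix.mul_apply, map_sum, map_mul, Finset.sum_mul, Finset.mul_sum]
  rw [Finset.sum_comm]
  exact Finset.sum_congr rfl fun i _ => Finset.sum_congr rfl fun j _ => by ring

theorem IsNormalized.eval_contactPoly_comp_eq_zero {g : GL (Fin 2) K} {s t : K}
    (hg : (c.comp g).IsNormalized)
    (hline : t * (c.normalPoly 0).eval s + (c.normalPoly 1).eval s = 0)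
    (hq : ∑ j : Fin 3, s ^ (j : ℕ) * eval ![t, 1] (c.q j) = 0) :
    (c.comp g).contactPoly.eval s = 0 := by
  obtain ⟨y, hy⟩ : ∃ y, g.val.mulVec y = ![t, 1] :=
    Matrix.mulVec_surjective_iff_isUnit.mpr g.isUnit _
  have hy0 : y 0 = y 1 * s ^ 3 := by
    have ht : g 0 0 * y 0 + g 0 1 * y 1 = t := by
      simpa [Matrix.mulVec, dotProduct] using congrFun hy 0
    have hone : g 1 0 * y 0 + g 1 1 * y 1 = 1 := by
      simpa [Matrix.mulVec, dotProduct] using congrFun hy 1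
    have h0 : 1 = g 0 0 * (c.normalPoly 0).eval s + g 1 0 * (c.normalPoly 1).eval s := by
      have h := congrArg (Polynomial.eval s) (c.normalPoly_comp g 0)
      rw [normalPoly, hg] at h
      simpa [Fin.sum_univ_four] using h
    have h1 : -s ^ 3 = g 0 1 * (c.normalPoly 0).eval s + g 1 1 * (c.normalPoly 1).eval s := by
      have h := congrArg (Polynomial.eval s) (c.normalPoly_comp g 1)
      rw [normalPoly, hg] at h
      simpa [Fin.sum_univ_four] using h
    linear_combination hline + y 0 * h0 + y 1 * h1 + (c.normalPoly 0).eval s * ht +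
      (c.normalPoly 1).eval s * hone
  have hysmul : y = y 1 • ![s ^ 3, 1] := funext (Fin.forall_fin_two.mpr (by simp [hy0]))
  have hy1 : y 1 ≠ 0 := fun h => by
    rw [hysmul, h, zero_smul, Matrix.mulVec_zero] at hy
    exact zero_ne_one (congrFun hy 1)
  have heval (j) : eval ![t, 1] (c.q j) = y 1 ^ 2 * eval ![s ^ 3, 1] ((c.comp g).q j) := by
    rw [← hy, ← eval_binaryCoords, ← eval_smul_of_isHomogeneous ((c.comp g).isHomogeneous_q j),
      ← hysmul, comp]
  refine mul_left_cancel₀ (pow_ne_zero 2 hy1) ?_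
  rw [mul_zero, ← hq, eval_contactPoly, Finset.mul_sum]
  exact Finset.sum_congr rfl fun j _ => by rw [heval]; ring

end LineExpansion

variable {F : MvPolynomial (Fin 4) K} {ℓ : Submodule K (Fin 4 → K)} {A : GL (Fin 4) K}
  {c : LineExpansion K}

variable [Infinite K]

theorem IsCuspidalCurve.infinite_setOf_isCusp (hA : IsAdapted A ℓ)
    (h : IsCuspidalCurve A F (points ℓ)) {S : Set K} (hS : S.Finite) :
    {s | ∃ t ∉ S, ∃ k, IsCusp (residualCubic (coords A F) t) ![0, k * s, k]}.Infinite := by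
  obtain ⟨S₀, hS₀, hclosure⟩ := h
  refine (hA.infinite_linePoint_mem
    (hclosure _ (hS.union hS₀) Set.subset_union_right)).mono fun s hs => ?_
  obtain ⟨t, ht, k, hk⟩ := linePoint_mem_cusps_iff.mp hs
  exact ⟨t, fun htS => ht (.inl htS), k, hk⟩

theorem IsCuspidalCurve.linearIndependent_normalPoly (hF : F.IsHomogeneous 4)
    (hsing : (singularPoints F).Finite) (hA : IsAdapted A ℓ) (hcoords : coords A F = c.quartic)
    (h : IsCuspidalCurve A F (points ℓ)) :
    LinearIndependent K ![c.normalPoly 0, c.normalPoly 1] := by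
  rw [LinearIndependent.pair_iff]
  intro a b hab
  by_contra hne
  refine h.infinite_setOf_isCusp hA (Set.finite_singleton (a / b))
    ((finite_setOf_normalPoly_eval_eq_zero hF hsing hcoords).subset ?_)
  rintro s ⟨t, ht, k, hk⟩
  rw [hcoords] at hk
  obtain ⟨hline, -, -⟩ := LineExpansion.isCusp_residualCubic_quartic hk
  have hs : a * (c.normalPoly 0).eval s + b * (c.normalPoly 1).eval s = 0 := by
    simpa using congrArg (Polynomial.eval s) hab
  have hfactor : a - b * t ≠ 0 := by
    refine fun hzero => hne ?_
    by_cases hb : b = 0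
    · exact ⟨by simpa [hb] using hzero, hb⟩
    · exact absurd (by rw [Set.mem_singleton_iff, eq_div_iff hb]; linear_combination -hzero) ht
  have h0 : (c.normalPoly 0).eval s = 0 := by
    refine (mul_eq_zero.mp (?_ : (a - b * t) * _ = 0)).resolve_left hfactor
    linear_combination hs - b * hline
  exact Fin.forall_fin_two.mpr ⟨h0, by linear_combination hline - t * h0⟩

variable [CharP K 3]

theorem IsCuspidalCurve.derivative_normalPoly_eq_zero (hF : F.IsHomogeneous 4)
    (hsing : (singularPoints F).Finite) (hA : IsAdapted A ℓ) (hcoords : coords A F = c.quartic)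
    (h : IsCuspidalCurve A F (points ℓ)) (k : Fin 2) : (c.normalPoly k).derivative = 0 := by
  have hlin := h.linearIndependent_normalPoly hF hsing hA hcoords
  have hwronskian : Polynomial.wronskian (c.normalPoly 0) (c.normalPoly 1) = 0 := by
    refine Polynomial.eq_zero_of_infinite_isRoot _
      ((h.infinite_setOf_isCusp hA Set.finite_empty).mono ?_)
    rintro s ⟨t, -, k, hk⟩
    rw [hcoords] at hk
    obtain ⟨hline, htangent, -⟩ := LineExpansion.isCusp_residualCubic_quartic hk
    rw [Set.mem_ofPred_eq, Polynomial.IsRoot, Polynomial.wronskian, Polynomial.eval_sub,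
      Polynomial.eval_mul, Polynomial.eval_mul]
    linear_combination (c.normalPoly 0).eval s * htangent -
      (c.normalPoly 0).derivative.eval s * hline
  revert k
  exact Fin.forall_fin_two.mpr (derivative_eq_zero_of_wronskian_eq_zero three_ne_zero
    (c.natDegree_normalPoly_le 0) (c.natDegree_normalPoly_le 1) hlin hwronskian)

theorem IsCuspidal.exists_projectivelyEquivalent_familyC (hF : F.IsHomogeneous 4)
    (hsing : (singularPoints F).Finite) (hℓ : IsLineOn F ℓ) (h : IsCuspidal F ℓ) :
    ∃ q₃ q₃' q₄ : MvPolynomial (Fin 2) K,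
      q₃.IsHomogeneous 3 ∧ q₃'.IsHomogeneous 3 ∧ q₄.IsHomogeneous 4 ∧
      ProjectivelyEquivalent F (familyC q₃ q₃' q₄) := by
  obtain ⟨-, A, hA, hcurve⟩ := h
  obtain ⟨c, hcoords⟩ := hA.exists_coords_eq_quartic hF hℓ
  obtain ⟨g, hg⟩ := LineExpansion.exists_isNormalized_comp
    (hcurve.linearIndependent_normalPoly hF hsing hA hcoords)
    (hcurve.derivative_normalPoly_eq_zero hF hsing hA hcoords)
  have hcontact : (c.comp g).contactPoly = 0 := by
    refine Polynomial.eq_zero_of_infinite_isRoot _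
      ((hcurve.infinite_setOf_isCusp hA Set.finite_empty).mono ?_)
    rintro s ⟨t, -, k, hk⟩
    rw [hcoords] at hk
    obtain ⟨hline, -, hq⟩ := LineExpansion.isCusp_residualCubic_quartic hk
    exact hg.eval_contactPoly_comp_eq_zero hline hq
  refine ⟨_, _, _, (c.comp g).isHomogeneous_r 1, (c.comp g).isHomogeneous_r 0,
    (c.comp g).isHomogeneous_m, A * pencilChange g, 1, one_ne_zero, ?_⟩
  rw [coords_mul, hcoords, c.coords_pencilChange_quartic, C_1, one_mul,
    hg.quartic_eq_familyC (LineExpansion.q_eq_zero_of_contactPoly_eq_zero hcontact)]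

end CuspidalCurve

end QuarticLines

theorem mainTheorem11_general {K : Type*} [Field K] [Infinite K] [PerfectField K] [CharP K 3]
    (F : MvPolynomial (Fin 4) K) (hF : F.IsHomogeneous 4)
    (hsing : (QuarticLines.singularPoints F).Finite)
    (ℓ : Submodule K (Fin 4 → K)) (hℓ : QuarticLines.IsLineOn F ℓ) :
    (QuarticLines.IsInseparable F ℓ → 12 < QuarticLines.valency F ℓ →
      QuarticLines.IsCuspidal F ℓ) ∧
    (QuarticLines.IsCuspidal F ℓ →
      ∃ q₃ q₃' q₄ : MvPolynomial (Fin 2) K,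
        q₃.IsHomogeneous 3 ∧ q₃'.IsHomogeneous 3 ∧ q₄.IsHomogeneous 4 ∧
        QuarticLines.ProjectivelyEquivalent F (QuarticLines.familyC q₃ q₃' q₄)) :=
  ⟨fun h hvalency => h.isCuspidal hF hsing hℓ hvalency,
    fun h => h.exists_projectivelyEquivalent_familyC hF hsing hℓ⟩

theorem mainTheorem11 {K : Type*} [Field K] [IsAlgClosed K] [CharP K 3]
    (F : MvPolynomial (Fin 4) K) (hF : QuarticLines.IsK3Quartic F)
    (ℓ : Submodule K (Fin 4 → K)) (hℓ : QuarticLines.IsLineOn F ℓ) :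
    (QuarticLines.IsInseparable F ℓ → 12 < QuarticLines.valency F ℓ →
      QuarticLines.IsCuspidal F ℓ) ∧
    (QuarticLines.IsCuspidal F ℓ →
      ∃ q₃ q₃' q₄ : MvPolynomial (Fin 2) K,
        q₃.IsHomogeneous 3 ∧ q₃'.IsHomogeneous 3 ∧ q₄.IsHomogeneous 4 ∧
        QuarticLines.ProjectivelyEquivalent F (QuarticLines.familyC q₃ q₃' q₄)) :=
  mainTheorem11_general F hF.isHomogeneous hF.isolated ℓ hℓ
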